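/- Let $n\ge 3$. Let $\mathbb{Q}(\boldsymbol{\ell})$ be the field of rational functions over $\mathbb{Q}$ in $\binom{n+1}{2}$ independent variables $\ell_{ij}=\ell_{ji}$, $0\le i<j\le n$ (with $\ell_{ii}=0$), thought of as the edge lengths of an $n$-simplex with vertices $0,\dots,n$, and let $\mathbb{F}$ be its algebraic closure. For a set $F=\{i_0,\dots,i_k\}$ of $k+1$ vertices, let $A_F\in\mathbb{F}$ be a square root of $$S_F=\frac{(-1)^{k+1}}{2^k(k!)^2}\det\begin{pmatrix}0&\mathbf{1}^{T}\\ \mathbf{1}&(\ell_{i_pi_q}^2)_{0\le p,q\le k}\end{pmatrix},$$ the Cayley--Menger polynomial of the squared $k$-volume of the face $F$ (the choice of the signs of the square roots is arbitrary). Let $V=A_{\{0,\dots,n\}}$ be the volume of the whole simplex, and let $A_{ijk}$ be the areas of its $2$-faces. Let $\Lambda_2\subset\mathbb{F}$ be the $\mathbb{Q}$-subalgebra generated by all $A_{ijk}$ and $A_{ijk}^{-1}$. Let $\widetilde{R}_2\subset\mathbb{F}$ be the $\mathbb{Q}$-subalgebra of all quotients $a/b$, where $a$ and $b$ are polynomials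 with rational coefficients in the elements $A_{ijk}$, $b\neq0$ in $\mathbb{F}$, and $b$ takes a non-zero value whenever the areas of the $2$-faces of a non-degenerate $n$-simplex in $\mathbb{R}^n$ are substituted for the $A_{ijk}$. Then $V$ is integral over $\Lambda_2$ if and only if $n\ge 6$. Hence, for $n\ge 6$, $V$ is integral over $\widetilde{R}_2$. -/

import Mathlib

open MeasureTheory

namespace SimplexVolume

/-- Edges of the `n`-simplex with vertices `0, …, n`: unordered pairs of distinct vertices. -/
abbrev Edge (n : ℕ) : Type := {e : Sym2 (Fin (n + 1)) // ¬ e.IsDiag}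

/-- `k`-faces of the `n`-simplex: sets of `k + 1` vertices. -/
abbrev Face (n k : ℕ) : Type := {F : Finset (Fin (n + 1)) // F.card = k + 1}

/-- The ring `ℚ[ℓ]` of polynomials in independent variables `ℓ_{ij} = ℓ_{ji}`, one per edge. -/
abbrev LengthPoly (n : ℕ) : Type := MvPolynomial (Edge n) ℚ

/-- The field `𝔽`, the algebraic closure of the field `ℚ(ℓ)` of rational functions. -/
abbrev FF (n : ℕ) : Type := AlgebraicClosure (FractionRing (LengthPoly n))

/-- The variable `ℓ_{ij}` for `i ≠ j`, and `ℓ_{ii} = 0`. -/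
noncomputable def len {n : ℕ} (i j : Fin (n + 1)) : LengthPoly n :=
  if h : i = j then 0 else MvPolynomial.X ⟨s(i, j), by simpa using h⟩

/-- The Cayley–Menger matrix of a `k`-face; `none` indexes the bordering row and column. -/
noncomputable def cayleyMengerMatrix {n k : ℕ} (F : Face n k) :
    Matrix (Option F.1) (Option F.1) (LengthPoly n)
  | none, none => 0
  | none, some _ => 1
  | some _, none => 1
  | some i, some j => len i.1 j.1 ^ 2

/-- The squared `k`-volume of a `k`-face as a polynomial in the edge lengths, given by the
Cayley–Menger formula. -/
noncomputable def sqVolPoly {n k : ℕ} (F : Face n k) : LengthPoly n :=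
  MvPolynomial.C ((-1) ^ (k + 1) / (2 ^ k * (k.factorial : ℚ) ^ 2)) * (cayleyMengerMatrix F).det

/-- The squared `k`-volume of a `k`-face as an element of `𝔽`. -/
noncomputable def sqVol {n k : ℕ} (F : Face n k) : FF n :=
  algebraMap (FractionRing (LengthPoly n)) (FF n)
    (algebraMap (LengthPoly n) (FractionRing (LengthPoly n)) (sqVolPoly F))

/-- The `k`-volume `A_F` of a `k`-face `F`: a square root in `𝔽` of the squared `k`-volume. -/
noncomputable def faceVol {n k : ℕ} (F : Face n k) : FF n :=
  Classical.choose (IsAlgClosed.exists_pow_nat_eq (sqVol F) (n := 2) two_pos)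

theorem faceVol_sq {n k : ℕ} (F : Face n k) : faceVol F ^ 2 = sqVol F :=
  Classical.choose_spec (IsAlgClosed.exists_pow_nat_eq (sqVol F) (n := 2) two_pos)

/-- The volume `V` of the whole `n`-simplex. -/
noncomputable def V (n : ℕ) : FF n :=
  faceVol (k := n) ⟨Finset.univ, by simp⟩

/-- The `ℚ`-subalgebra `Λ_k` of `𝔽` generated by all `A_F` and `A_F⁻¹`, for `k`-faces `F`. -/
noncomputable def laurentAlg (n k : ℕ) : Subalgebra ℚ (FF n) :=
  Algebra.adjoin ℚ
    (Set.range (fun F : Face n k => faceVol F) ∪ Set.range (fun F : Face n k => (faceVol F)⁻¹))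

/-- The actual `k`-volume of the `k`-face `F` of a non-degenerate simplex `Δ` in `ℝⁿ`: the
`k`-dimensional Euclidean measure of the convex hull of its vertices. -/
noncomputable def realFaceVol {n k : ℕ} (Δ : Affine.Simplex ℝ (EuclideanSpace ℝ (Fin n)) n)
    (F : Face n k) : ℝ :=
  (μHE[k] : Measure (EuclideanSpace ℝ (Fin n))).real (convexHull ℝ (Δ.points '' (F.1 : Set _)))

/-- The polynomial `b` in the `k`-volumes of the `k`-faces vanishes at no non-degenerate
`n`-simplex in `ℝⁿ`. -/
def NonvanishingOnSimplices {n k : ℕ} (b : MvPolynomial (Face n k) ℚ) : Prop :=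
  ∀ Δ : Affine.Simplex ℝ (EuclideanSpace ℝ (Fin n)) n,
    MvPolynomial.aeval (fun F : Face n k => realFaceVol Δ F) b ≠ 0

/-- The `ℚ`-algebra of rational functions `a(A_k) / b(A_k)` in the `k`-volumes of the `k`-faces
whose denominators `b(A_k)` are non-zero elements of `𝔽` (so that the quotient makes sense) and
vanish at no non-degenerate `n`-simplex. -/
noncomputable def regularAlg (n k : ℕ) : Subalgebra ℚ (FF n) where
  carrier := {x | ∃ a b : MvPolynomial (Face n k) ℚ, NonvanishingOnSimplices b ∧
    MvPolynomial.aeval (fun F : Face n k => faceVol F) b ≠ 0 ∧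
    x = MvPolynomial.aeval (fun F : Face n k => faceVol F) a /
      MvPolynomial.aeval (fun F : Face n k => faceVol F) b}
  mul_mem' := by
    rintro x y ⟨a, b, hb, hb0, rfl⟩ ⟨c, d, hd, hd0, rfl⟩
    refine ⟨a * c, b * d, fun Δ => ?_, ?_, ?_⟩
    · rw [map_mul]; exact mul_ne_zero (hb Δ) (hd Δ)
    · rw [map_mul]; exact mul_ne_zero hb0 hd0
    · rw [map_mul, map_mul, div_mul_div_comm]
  add_mem' := by
    rintro x y ⟨a, b, hb, hb0, rfl⟩ ⟨c, d, hd, hd0, rfl⟩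
    refine ⟨a * d + b * c, b * d, fun Δ => ?_, ?_, ?_⟩
    · rw [map_mul]; exact mul_ne_zero (hb Δ) (hd Δ)
    · rw [map_mul]; exact mul_ne_zero hb0 hd0
    · rw [map_mul, map_add, map_mul, map_mul, div_add_div _ _ hb0 hd0]
  algebraMap_mem' r :=
    ⟨MvPolynomial.C r, 1, fun Δ => by simp, by simp, by
      rw [map_one, div_one]; exact (MvPolynomial.aeval_C _ r).symm⟩

end SimplexVolume

/-!
The volume `V` is integral over the algebra `Λ` generated by the areas and their inverses exactly
when it lies in every valuation ring `O ⊇ Λ` of `𝔽`, that is, when `V` stays finite whenever all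
areas degenerate to finite non-zero values.

*Integrality for `n ≥ 6`.* Let `O ⊇ Λ` be a valuation ring. If all squared edge lengths lie in `O`,
so does `V²`. Otherwise divide them by the largest one, `X = ℓ_{oe}²`. The rescaled squared lengths
`x` lie in `O`, and each triangle has squared area a unit multiple of `ε = X⁻²`, so modulo `ε` all
triangles are flat. Place `o` and `e` at `0` and `1` on an axis, and describe a vertex `a` by its
coordinate `s_a` on the axis and the inner products `p_{ab}` of the components perpendicular to it.
Flatness modulo `ε` gives `p_{aa} = 0`, and shows that `p_{ab}` vanishes unless
`s_a + s_b = 1` and `p_{ab} = -2 s_a s_b`, at least where neither vertex is residually at an end of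
the axis. The pairs with `p_{ab} ≠ 0` form a complete bipartite graph on the inner vertices, whose
two sides have constant rows of `p`: residually the vertices are either collinear or lie in four
clusters that form a degenerate tetrahedron with equal opposite edges. In both cases the bordered
Cayley–Menger matrix is spanned modulo `ε` by the border and at most four further rows
(`exists_rows_span_of_flat`). Hence its determinant is divisible by `ε ^ (n - 3)`, and `V²` is
`X ^ n ε ^ (n - 3) = X ^ (6 - n)` times an element of `O`. That the areas are units, and not merely
elements of `O`, is used once: it leaves room for only one vertex infinitely close to `o` or to
`e` (`eq_of_not_isUnit`), so that an inner vertex exists.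

*Failure for `n = 3, 4, 5`.* The degeneration of the second kind is realised by an explicit family:
a tetrahedron with two opposite edges of squared length `4τ - 1/τ` and the others of squared length
`τ`, with one or two vertices doubled at squared distance `1/τ`. As `τ → ∞` all areas stay bounded
away from `0` and `∞`, while `|V|` grows without bound (`le_abs_det_clusterMatrix`). Homomorphisms
from `ℚ[ℓ]` to `ℂ` extend to its integral closure in `𝔽`, so an equation of integral dependence
would bound `V` on the family (`not_isIntegral_of_unbounded`).

Finally `Λ` is contained in the algebra of regular quotients, since the area of a triangle of a
non-degenerate simplex is non-zero.
-/

namespace SimplexVolume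

/-! ### Bordered matrices of squared distances -/

/-- Sixteen times the squared area of a triangle in terms of its squared side lengths. -/
def heron {R : Type*} [CommRing R] (x y z : R) : R :=
  2 * (x * y + y * z + z * x) - x ^ 2 - y ^ 2 - z ^ 2

/-- The bordered matrix of squared distances `x`; `none` indexes the bordering row and column. -/
def cmMatrix {R ι : Type*} [CommRing R] (x : ι → ι → R) : Matrix (Option ι) (Option ι) R
  | none, none => 0
  | none, some _ => 1
  | some _, none => 1
  | some i, some j => x i j

/-- If modulo `ε` all rows outside `T` are linear combinations of the rows in `T`, then `ε` divides
the determinant at least once for each row outside `T`. -/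
theorem pow_dvd_det_of_rows_mem_span {R m : Type*} [CommRing R] [Fintype m] [DecidableEq m]
    (M : Matrix m m R) (ε : R) (T : Finset m)
    (h : ∀ a ∉ T, (M.map (Ideal.Quotient.mk (Ideal.span {ε}))).row a ∈
      Submodule.span (R ⧸ Ideal.span {ε})
        ((M.map (Ideal.Quotient.mk (Ideal.span {ε}))).row '' (T : Set m)))
    {k : ℕ} (hk : T.card + k ≤ Fintype.card m) : ε ^ k ∣ M.det := by
  classical
  have h' : ∀ a, ∃ c : m → R, a ∉ T →
      (∀ r ∉ T, c r = 0) ∧ ∀ b, ε ∣ M a b - ∑ r, c r * M r b := by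
    intro a
    by_cases ha : a ∈ T
    · exact ⟨0, fun h => absurd ha h⟩
    obtain ⟨l, hl, hla⟩ := (Finsupp.mem_span_image_iff_linearCombination _).1 (h a ha)
    choose f hf using fun r => Ideal.Quotient.mk_surjective (I := Ideal.span {ε}) (l r)
    refine ⟨fun r => if r ∈ T then f r else 0, fun _ => ⟨fun r hr => if_neg hr, fun b => ?_⟩⟩
    rw [← Ideal.mem_span_singleton, ← Ideal.Quotient.eq_zero_iff_mem, map_sub, sub_eq_zero]
    have := congrFun hla b
    rw [Finsupp.linearCombination_apply, Finsupp.sum_fintype _ _ (by simp)] at this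
    simp only [Finset.sum_apply, Pi.smul_apply, Matrix.row_apply, Matrix.map_apply,
      smul_eq_mul] at this
    rw [← this, map_sum]
    refine Finset.sum_congr rfl fun r _ => ?_
    by_cases hr : r ∈ T
    · simp only [if_pos hr, map_mul, hf]
    · have : l r = 0 := by
        by_contra hne
        exact hr (by simpa using hl (Finsupp.mem_support_iff.2 hne))
      simp only [if_neg hr, this, zero_mul, map_zero]
  choose c hc using h'
  -- The row operations are multiplication by the unipotent matrix `1 - N`.
  let N : Matrix m m R := Matrix.of fun a b => if a ∈ T then 0 else c a b
  have hL : (1 - N).det = 1 := by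
    rw [Matrix.twoBlockTriangular_det (1 - N) (fun a => a ∉ T)]
    · have h1 : (1 - N).toSquareBlockProp (fun a => a ∉ T) = 1 := by
        ext ⟨a, ha⟩ ⟨b, hb⟩
        simp [Matrix.toSquareBlockProp, N, ha, (hc a ha).1 b hb, Matrix.one_apply]
      have h2 : (1 - N).toSquareBlockProp (fun a => ¬ a ∉ T) = 1 := by
        ext ⟨a, ha⟩ ⟨b, hb⟩
        have ha' : a ∈ T := not_not.1 ha
        simp [Matrix.toSquareBlockProp, N, ha', Matrix.one_apply]
      rw [h1, h2]; simp
    · intro a ha b hb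
      have ha' : a ∈ T := not_not.1 ha
      have hab : a ≠ b := fun h => hb (h ▸ ha')
      simp [N, ha', hab]
  have hrow : ∀ a b, ∃ y, ((1 - N) * M) a b = (if a ∈ T then 1 else ε) * y := by
    intro a b
    by_cases ha : a ∈ T
    · exact ⟨_, by rw [if_pos ha, one_mul]⟩
    · obtain ⟨y, hy⟩ := (hc a ha).2 b
      refine ⟨y, ?_⟩
      rw [if_neg ha, ← hy, sub_mul, one_mul, Matrix.sub_apply, Matrix.mul_apply]
      simp [N, ha]
  choose Y hY using hrow
  have hdet : M.det = (∏ a, if a ∈ T then 1 else ε) * (Matrix.of Y).det := by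
    rw [← Matrix.det_mul_column]
    calc M.det = ((1 - N) * M).det := by rw [Matrix.det_mul, hL, one_mul]
      _ = _ := by congr 1; ext a b; rw [hY]; rfl
  rw [hdet]
  refine Dvd.dvd.mul_right ?_ _
  rw [Finset.prod_ite, Finset.prod_const_one, one_mul, Finset.prod_const]
  refine pow_dvd_pow _ ?_
  have : (Finset.univ.filter fun a => a ∉ T) = Tᶜ := by ext; simp
  rw [this, Finset.card_compl]
  omega

/-! ### Coordinates along an axis -/

section Perp

variable {R ι : Type*} [CommRing R]

/-- For squared distances `x` with `x o e = 1`, and `h = 1/2`: the coordinate of the vertex `a`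
along the axis from `o` to `e`. -/
def axial (h : R) (x : ι → ι → R) (o e a : ι) : R := h * (x o a + 1 - x e a)

/-- For squared distances `x` with `x o e = 1`, and `h = 1/2`: the inner product of the components
of the vertices `a` and `b` perpendicular to the axis from `o` to `e`. -/
def perp (h : R) (x : ι → ι → R) (o e a b : ι) : R :=
  h * (x o a + x o b - x a b) - axial h x o e a * axial h x o e b

variable {h : R} {x : ι → ι → R} {o e : ι}

theorem perp_comm (hs : ∀ a b, x a b = x b a) (a b : ι) :
    perp h x o e a b = perp h x o e b a := by
  simp only [perp, hs a b]; ring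

theorem sqDist_eq (hh : 2 * h = 1) (h0 : ∀ a, x a a = 0) (a b : ι) :
    x a b = (axial h x o e a - axial h x o e b) ^ 2 + perp h x o e a a + perp h x o e b b
      - 2 * perp h x o e a b := by
  simp only [perp, h0]; linear_combination (-x a b) * hh

theorem axial_left (hs : ∀ a b, x a b = x b a) (h0 : ∀ a, x a a = 0)
    (hoe : x o e = 1) : axial h x o e o = 0 := by
  simp only [axial, h0, hs e o, hoe]; ring

theorem axial_right (hh : 2 * h = 1) (h0 : ∀ a, x a a = 0)
    (hoe : x o e = 1) : axial h x o e e = 1 := by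
  simp only [axial, h0, hoe]; linear_combination hh

theorem perp_left (hs : ∀ a b, x a b = x b a) (h0 : ∀ a, x a a = 0)
    (hoe : x o e = 1) (a : ι) : perp h x o e o a = 0 := by
  simp only [perp, axial, h0, hs e o, hoe]; ring

theorem perp_right (hh : 2 * h = 1) (h0 : ∀ a, x a a = 0)
    (hoe : x o e = 1) (a : ι) : perp h x o e e a = 0 := by
  simp only [perp, axial, h0, hoe]
  linear_combination (- h * (x o a + 1 - x e a)) * hh

theorem sqDist_left (hh : 2 * h = 1) (hs : ∀ a b, x a b = x b a) (h0 : ∀ a, x a a = 0)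
    (hoe : x o e = 1) (a : ι) : x o a = axial h x o e a ^ 2 + perp h x o e a a := by
  rw [sqDist_eq hh h0 (o := o) (e := e), axial_left hs h0 hoe, perp_left hs h0 hoe,
    perp_left hs h0 hoe]; ring

theorem sqDist_right (hh : 2 * h = 1) (h0 : ∀ a, x a a = 0)
    (hoe : x o e = 1) (a : ι) : x e a = (1 - axial h x o e a) ^ 2 + perp h x o e a a := by
  rw [sqDist_eq hh h0 (o := o) (e := e), axial_right hh h0 hoe, perp_right hh h0 hoe,
    perp_right hh h0 hoe]; ring

theorem heron_axis (hh : 2 * h = 1) (hs : ∀ a b, x a b = x b a) (h0 : ∀ a, x a a = 0)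
    (hoe : x o e = 1) (a : ι) : heron (x o e) (x e a) (x a o) = 4 * perp h x o e a a := by
  rw [hs a o, sqDist_left hh hs h0 hoe a, sqDist_right hh h0 hoe a, hoe, heron]; ring

theorem heron_left (hh : 2 * h = 1) (hs : ∀ a b, x a b = x b a) (h0 : ∀ a, x a a = 0)
    (hoe : x o e = 1) (a b : ι) : heron (x o a) (x a b) (x b o) =
      4 * ((axial h x o e a ^ 2 + perp h x o e a a) * (axial h x o e b ^ 2 + perp h x o e b b)
        - (axial h x o e a * axial h x o e b + perp h x o e a b) ^ 2) := by
  rw [hs b o, sqDist_left hh hs h0 hoe a, sqDist_left hh hs h0 hoe b,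
    sqDist_eq hh h0 (o := o) (e := e) a b, heron]; ring

theorem heron_right (hh : 2 * h = 1) (hs : ∀ a b, x a b = x b a) (h0 : ∀ a, x a a = 0)
    (hoe : x o e = 1) (a b : ι) : heron (x e a) (x a b) (x b e) =
      4 * (((1 - axial h x o e a) ^ 2 + perp h x o e a a) *
          ((1 - axial h x o e b) ^ 2 + perp h x o e b b)
        - ((1 - axial h x o e a) * (1 - axial h x o e b) + perp h x o e a b) ^ 2) := by
  rw [hs b e, sqDist_right hh h0 hoe a, sqDist_right hh h0 hoe b,
    sqDist_eq hh h0 (o := o) (e := e) a b, heron]; ring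

end Perp

/-! ### Flat triangles over a local ring -/

section Flat

variable {A ι : Type*} [CommRing A] [IsLocalRing A] {h : A} {x : ι → ι → A} {o e : ι}

omit [IsLocalRing A] in
theorem perp_self_of_flat (hh : 2 * h = 1) (hs : ∀ a b, x a b = x b a) (h0 : ∀ a, x a a = 0)
    (hoe : x o e = 1) (hH : ∀ a b c, heron (x a b) (x b c) (x c a) = 0) (a : ι) :
    perp h x o e a a = 0 := by
  have := heron_axis hh hs h0 hoe a
  rw [hH] at this
  linear_combination (-h ^ 2) * this - (2 * h + 1) * perp h x o e a a * hh

omit [IsLocalRing A] in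
/-- The perpendicular inner product `p` and the coordinates `s`, `t` of two vertices satisfy
`p (p + 2 s t) = 0`, and `p (s + t - 1) = 0`. -/
theorem perp_mul_of_flat (hh : 2 * h = 1) (hs : ∀ a b, x a b = x b a) (h0 : ∀ a, x a a = 0)
    (hoe : x o e = 1) (hH : ∀ a b c, heron (x a b) (x b c) (x c a) = 0) (a b : ι) :
    perp h x o e a b * (perp h x o e a b + 2 * axial h x o e a * axial h x o e b) = 0 ∧
    perp h x o e a b * (axial h x o e a + axial h x o e b - 1) = 0 := by
  have h1 := heron_left hh hs h0 hoe a b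
  have h2 := heron_right hh hs h0 hoe a b
  rw [hH, perp_self_of_flat hh hs h0 hoe hH, perp_self_of_flat hh hs h0 hoe hH] at h1 h2
  generalize perp h x o e a b = p at *
  generalize axial h x o e a = s at *
  generalize axial h x o e b = t at *
  have h4 : 4 * h ^ 2 = 1 := by linear_combination (2 * h + 1) * hh
  have h8 : 8 * h ^ 3 = 1 := by linear_combination (4 * h ^ 2 + 2 * h + 1) * hh
  constructor
  · linear_combination h ^ 2 * h1 - p * (p + 2 * s * t) * h4
  · linear_combination h ^ 3 * h1 - h ^ 3 * h2 - p * (s + t - 1) * h8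

/-- A non-zero perpendicular inner product need not be a unit, so it can be cancelled from the
relations of `perp_mul_of_flat` only residually. -/
theorem residue_of_perp_ne_zero (hh : 2 * h = 1) (hs : ∀ a b, x a b = x b a)
    (h0 : ∀ a, x a a = 0) (hoe : x o e = 1)
    (hH : ∀ a b c, heron (x a b) (x b c) (x c a) = 0) {a b : ι} (hab : perp h x o e a b ≠ 0) :
    IsLocalRing.residue A (axial h x o e a) + IsLocalRing.residue A (axial h x o e b) = 1 ∧
    IsLocalRing.residue A (perp h x o e a b) = -2 * IsLocalRing.residue A (axial h x o e a) *
      IsLocalRing.residue A (axial h x o e b) := by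
  obtain ⟨h1, h2⟩ := perp_mul_of_flat hh hs h0 hoe hH a b
  have key : ∀ u : A, perp h x o e a b * u = 0 → IsLocalRing.residue A u = 0 := by
    intro u hu
    rw [IsLocalRing.residue_eq_zero_iff, IsLocalRing.mem_maximalIdeal, mem_nonunits_iff]
    exact fun hun => hab ((hun.mul_left_eq_zero).1 hu)
  have k1 := key _ h1
  have k2 := key _ h2
  simp only [map_add, map_sub, map_mul, map_one, map_ofNat] at k1 k2
  exact ⟨by linear_combination k2, by linear_combination k1⟩

/-- A vertex whose residual coordinate on the axis is neither `0` nor `1`. -/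
def IsInner (h : A) (x : ι → ι → A) (o e c : ι) : Prop :=
  IsLocalRing.residue A (axial h x o e c) ≠ 0 ∧ IsLocalRing.residue A (axial h x o e c) ≠ 1

theorem isInner_of_isUnit (hh : 2 * h = 1) (hs : ∀ a b, x a b = x b a) (h0 : ∀ a, x a a = 0)
    (hoe : x o e = 1) (hH : ∀ a b c, heron (x a b) (x b c) (x c a) = 0) {c : ι}
    (h1 : IsUnit (x o c)) (h2 : IsUnit (x e c)) : IsInner h x o e c := by
  rw [sqDist_left hh hs h0 hoe, perp_self_of_flat hh hs h0 hoe hH, add_zero] at h1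
  rw [sqDist_right hh h0 hoe, perp_self_of_flat hh hs h0 hoe hH, add_zero] at h2
  have h1 := (isUnit_of_mul_isUnit_left (pow_two (axial h x o e c) ▸ h1)).map
    (IsLocalRing.residue A)
  have h2 := (isUnit_of_mul_isUnit_left (pow_two (1 - axial h x o e c) ▸ h2)).map
    (IsLocalRing.residue A)
  rw [map_sub, map_one] at h2
  exact ⟨h1.ne_zero, fun h => h2.ne_zero (by rw [h, sub_self])⟩

theorem IsInner.of_perp_ne_zero (hh : 2 * h = 1) (hs : ∀ a b, x a b = x b a)
    (h0 : ∀ a, x a a = 0) (hoe : x o e = 1)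
    (hH : ∀ a b c, heron (x a b) (x b c) (x c a) = 0) {a b : ι} (ha : IsInner h x o e a)
    (hab : perp h x o e a b ≠ 0) : IsInner h x o e b := by
  have h1 := (residue_of_perp_ne_zero hh hs h0 hoe hH hab).1
  exact ⟨fun h => ha.2 (by rw [h, add_zero] at h1; exact h1),
    fun h => ha.1 (by rw [h] at h1; linear_combination h1)⟩

/-- Call two vertices joined if their perpendicular inner product is non-zero. Every inner vertex is
joined to a member of each joined pair: otherwise the triangle it forms with the pair would not be
flat. -/
theorem perp_ne_zero_or (hh : 2 * h = 1) (hs : ∀ a b, x a b = x b a)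
    (h0 : ∀ a, x a a = 0) (hoe : x o e = 1)
    (hH : ∀ a b c, heron (x a b) (x b c) (x c a) = 0) {a b c : ι} (hc : IsInner h x o e c)
    (hab : perp h x o e a b ≠ 0) : perp h x o e a c ≠ 0 ∨ perp h x o e b c ≠ 0 := by
  by_contra! hcon
  obtain ⟨h1, h2⟩ := residue_of_perp_ne_zero hh hs h0 hoe hH hab
  have hT := hH a b c
  rw [sqDist_eq hh h0 (o := o) (e := e) a b, sqDist_eq hh h0 (o := o) (e := e) b c,
    sqDist_eq hh h0 (o := o) (e := e) c a, perp_comm hs c a, hcon.1, hcon.2,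
    perp_self_of_flat hh hs h0 hoe hH, perp_self_of_flat hh hs h0 hoe hH,
    perp_self_of_flat hh hs h0 hoe hH, heron] at hT
  set p := perp h x o e a b
  set s := axial h x o e a
  set t := axial h x o e b
  set r := axial h x o e c
  have hu : p * (8 * (s - r) * (r - t) - 4 * p) = 0 := by linear_combination hT
  have hun : IsUnit (8 * (s - r) * (r - t) - 4 * p) := by
    have h2u : IsUnit (2 : A) := IsUnit.of_mul_eq_one h hh
    have h2k : (2 : IsLocalRing.ResidueField A) ≠ 0 := by
      have := (h2u.map (IsLocalRing.residue A)).ne_zero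
      rwa [map_ofNat] at this
    rw [← IsLocalRing.residue_ne_zero_iff_isUnit]
    have : IsLocalRing.residue A (8 * (s - r) * (r - t) - 4 * p) =
        2 ^ 3 * IsLocalRing.residue A r * (1 - IsLocalRing.residue A r) := by
      simp only [map_sub, map_mul, map_ofNat]
      linear_combination (-4) * h2 + 8 * IsLocalRing.residue A r * h1
    rw [this]
    exact mul_ne_zero (mul_ne_zero (pow_ne_zero _ h2k) hc.1) (sub_ne_zero.2 (Ne.symm hc.2))
  exact hab ((hun.mul_left_eq_zero).1 hu)

/-- Three mutually joined vertices would form an equilateral triangle, which is not flat. -/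
theorem perp_eq_zero_of_ne_zero (hh : 2 * h = 1) (h3 : IsUnit (3 : A))
    (hs : ∀ a b, x a b = x b a)
    (h0 : ∀ a, x a a = 0) (hoe : x o e = 1)
    (hH : ∀ a b c, heron (x a b) (x b c) (x c a) = 0) {a b c : ι}
    (hab : perp h x o e a b ≠ 0) (hac : perp h x o e a c ≠ 0) : perp h x o e b c = 0 := by
  by_contra hbc
  obtain ⟨h1, h1'⟩ := residue_of_perp_ne_zero hh hs h0 hoe hH hab
  obtain ⟨h2, h2'⟩ := residue_of_perp_ne_zero hh hs h0 hoe hH hac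
  obtain ⟨h3', h3''⟩ := residue_of_perp_ne_zero hh hs h0 hoe hH hbc
  have hT := congrArg (IsLocalRing.residue A) (hH a b c)
  rw [sqDist_eq hh h0 (o := o) (e := e) a b, sqDist_eq hh h0 (o := o) (e := e) b c,
    sqDist_eq hh h0 (o := o) (e := e) c a, perp_comm hs c a,
    perp_self_of_flat hh hs h0 hoe hH, perp_self_of_flat hh hs h0 hoe hH,
    perp_self_of_flat hh hs h0 hoe hH, heron] at hT
  simp only [map_add, map_sub, map_mul, map_pow, map_zero, map_ofNat, h1', h2', h3''] at hT
  have hhk := congrArg (IsLocalRing.residue A) hh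
  simp only [map_mul, map_one, map_ofNat] at hhk
  set η := IsLocalRing.residue A h
  have e1 : IsLocalRing.residue A (axial h x o e a) = η := by
    linear_combination η * h1 + η * h2 - η * h3' - IsLocalRing.residue A (axial h x o e a) * hhk
  have e2 : IsLocalRing.residue A (axial h x o e b) = η := by
    linear_combination h1 - e1 - hhk
  have e3 : IsLocalRing.residue A (axial h x o e c) = η := by
    linear_combination h2 - e1 - hhk
  rw [e1, e2, e3] at hT
  have h3k := (h3.map (IsLocalRing.residue A)).ne_zero
  rw [map_ofNat] at h3k
  apply h3k
  have : (2 * η) ^ 4 * 3 = 0 := by linear_combination hT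
  rwa [hhk, one_pow, one_mul] at this

/-- When `a` is an inner vertex, `perp h x o e a b` is a unit as soon as it is non-zero, so the
residual relations of `residue_of_perp_ne_zero` hold exactly. -/
theorem perp_eq_of_ne_zero (hh : 2 * h = 1) (hs : ∀ a b, x a b = x b a)
    (h0 : ∀ a, x a a = 0) (hoe : x o e = 1)
    (hH : ∀ a b c, heron (x a b) (x b c) (x c a) = 0) {a b : ι} (ha : IsInner h x o e a)
    (hab : perp h x o e a b ≠ 0) : axial h x o e a + axial h x o e b = 1 ∧
      perp h x o e a b = -2 * axial h x o e a * axial h x o e b := by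
  have hb := ha.of_perp_ne_zero hh hs h0 hoe hH hab
  have hun : IsUnit (perp h x o e a b) := by
    have h2k := ((IsUnit.of_mul_eq_one h hh).map (IsLocalRing.residue A)).ne_zero
    rw [map_ofNat] at h2k
    rw [← IsLocalRing.residue_ne_zero_iff_isUnit,
      (residue_of_perp_ne_zero hh hs h0 hoe hH hab).2]
    exact mul_ne_zero (mul_ne_zero (neg_ne_zero.2 h2k) ha.1) hb.1
  obtain ⟨h1, h2⟩ := perp_mul_of_flat hh hs h0 hoe hH a b
  rw [hun.mul_right_eq_zero] at h1 h2
  exact ⟨by linear_combination h2, by linear_combination h1⟩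

/-- Two neighbours `a`, `j` of the same vertex have the same perpendicular inner products. -/
theorem perp_eq_perp_of_ne_zero (hh : 2 * h = 1) (h3 : IsUnit (3 : A))
    (hs : ∀ a b, x a b = x b a) (h0 : ∀ a, x a a = 0) (hoe : x o e = 1)
    (hH : ∀ a b c, heron (x a b) (x b c) (x c a) = 0) {i j a : ι} (hi : IsInner h x o e i)
    (hij : perp h x o e i j ≠ 0) (hia : perp h x o e i a ≠ 0) (b : ι) :
    perp h x o e a b = perp h x o e j b := by
  have key : ∀ {a j : ι}, perp h x o e i j ≠ 0 → perp h x o e i a ≠ 0 →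
      perp h x o e a b ≠ 0 → perp h x o e j b ≠ 0 := by
    intro a j hij hia hab
    have ha := hi.of_perp_ne_zero hh hs h0 hoe hH hia
    have hb := ha.of_perp_ne_zero hh hs h0 hoe hH hab
    refine (perp_ne_zero_or hh hs h0 hoe hH hb hij).resolve_left fun hib => ?_
    exact hab (perp_eq_zero_of_ne_zero hh h3 hs h0 hoe hH hia hib)
  by_cases hab : perp h x o e a b = 0
  · rw [hab]
    by_contra hjb
    exact key hia hij (Ne.symm hjb) hab
  · have hjb := key hij hia hab
    have ha := hi.of_perp_ne_zero hh hs h0 hoe hH hia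
    have hj := hi.of_perp_ne_zero hh hs h0 hoe hH hij
    rw [(perp_eq_of_ne_zero hh hs h0 hoe hH ha hab).2,
      (perp_eq_of_ne_zero hh hs h0 hoe hH hj hjb).2]
    have e1 := (perp_eq_of_ne_zero hh hs h0 hoe hH hi hij).1
    have e2 := (perp_eq_of_ne_zero hh hs h0 hoe hH hi hia).1
    linear_combination 2 * axial h x o e b * (e1 - e2)

/-- The perpendicular inner products with `a`, as a row of the bordered matrix. -/
def perpRow (h : A) (x : ι → ι → A) (o e a : ι) : Option ι → A
  | none => 0
  | some b => perp h x o e a b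

omit [IsLocalRing A] in
/-- Up to the rows of `o`, `e` and the border, the row of `a` in the bordered matrix is its row of
perpendicular inner products. -/
theorem row_eq (hh : 2 * h = 1) (a : ι) :
    (cmMatrix x).row (some a) = (1 - axial h x o e a) • (cmMatrix x).row (some o)
      + axial h x o e a • (cmMatrix x).row (some e)
      + (h * (x o a + x e a - 1)) • (cmMatrix x).row none - (2 : A) • perpRow h x o e a := by
  funext b
  cases b with
  | none => simp [Matrix.row, cmMatrix, perpRow]
  | some b =>
    simp only [Matrix.row, cmMatrix, perpRow, perp, Pi.add_apply, Pi.sub_apply, Pi.smul_apply,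
      smul_eq_mul]
    simp only [axial]
    linear_combination (-x a b + x o b - h * (x o a + 1 - x e a) * (x o b + 1 - x e b)) * hh

/-- If all triangles are flat and some vertex is inner, then the bordered matrix of squared
distances is spanned by its border row and the rows of at most four vertices. -/
theorem exists_rows_span_of_flat [DecidableEq ι] (hh : 2 * h = 1) (h3 : IsUnit (3 : A))
    (hs : ∀ a b, x a b = x b a) (h0 : ∀ a, x a a = 0) (hoe : x o e = 1)
    (hH : ∀ a b c, heron (x a b) (x b c) (x c a) = 0) (hc : ∃ c, IsInner h x o e c) :
    ∃ T : Finset (Option ι), T.card ≤ 5 ∧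
      ∀ a, (cmMatrix x).row a ∈ Submodule.span A ((cmMatrix x).row '' (T : Set (Option ι))) := by
  have main : ∀ T : Finset (Option ι), none ∈ T → some o ∈ T → some e ∈ T →
      (∀ a, (2 : A) • perpRow h x o e a ∈
        Submodule.span A ((cmMatrix x).row '' (T : Set (Option ι)))) →
      ∀ a, (cmMatrix x).row a ∈ Submodule.span A ((cmMatrix x).row '' (T : Set (Option ι))) := by
    intro T hn ho he hT a
    have hmem : ∀ t ∈ T, (cmMatrix x).row t ∈
        Submodule.span A ((cmMatrix x).row '' (T : Set (Option ι))) := fun t ht =>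
      Submodule.subset_span (Set.mem_image_of_mem _ (Finset.mem_coe.2 ht))
    cases a with
    | none => exact hmem _ hn
    | some a =>
      rw [row_eq (o := o) (e := e) hh a]
      exact Submodule.sub_mem _ (Submodule.add_mem _ (Submodule.add_mem _
        (Submodule.smul_mem _ _ (hmem _ ho)) (Submodule.smul_mem _ _ (hmem _ he)))
        (Submodule.smul_mem _ _ (hmem _ hn))) (hT a)
  have hzero : ∀ a, (∀ b, perp h x o e a b = 0) → perpRow h x o e a = 0 := by
    intro a ha
    funext b
    cases b with
    | none => rfl
    | some b => exact ha b
  by_cases hbad : ∃ i j, perp h x o e i j ≠ 0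
  swap
  · push Not at hbad
    refine ⟨{none, some o, some e}, (Finset.card_le_three).trans (by norm_num), ?_⟩
    refine main _ (by simp) (by simp) (by simp) fun a => ?_
    rw [hzero a (hbad a), smul_zero]
    exact Submodule.zero_mem _
  obtain ⟨i, j, hij⟩ := hbad
  obtain ⟨c, hc⟩ := hc
  have inner : ∀ {a b}, perp h x o e a b ≠ 0 → IsInner h x o e a := by
    intro a b hab
    rcases perp_ne_zero_or hh hs h0 hoe hH hc hab with hac | hbc
    · exact hc.of_perp_ne_zero hh hs h0 hoe hH (perp_comm hs a c ▸ hac)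
    · exact (hc.of_perp_ne_zero hh hs h0 hoe hH (perp_comm hs b c ▸ hbc)).of_perp_ne_zero
        hh hs h0 hoe hH (perp_comm hs a b ▸ hab)
  have hji : perp h x o e j i ≠ 0 := perp_comm hs i j ▸ hij
  let T : Finset (Option ι) := {none, some o, some e, some i, some j}
  have hT : ∀ k, some k ∈ T → (2 : A) • perpRow h x o e k ∈
      Submodule.span A ((cmMatrix x).row '' (T : Set (Option ι))) := by
    intro k hk
    have hmem : ∀ t ∈ T, (cmMatrix x).row t ∈
        Submodule.span A ((cmMatrix x).row '' (T : Set (Option ι))) := fun t ht =>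
      Submodule.subset_span (Set.mem_image_of_mem _ (Finset.mem_coe.2 ht))
    have := row_eq (o := o) (e := e) (x := x) hh k
    rw [eq_sub_iff_add_eq', ← eq_sub_iff_add_eq] at this
    rw [this]
    exact Submodule.sub_mem _ (Submodule.add_mem _ (Submodule.add_mem _
        (Submodule.smul_mem _ _ (hmem _ (by simp [T])))
        (Submodule.smul_mem _ _ (hmem _ (by simp [T]))))
        (Submodule.smul_mem _ _ (hmem _ (by simp [T])))) (hmem _ hk)
  refine ⟨T, Finset.card_le_five, main T (by simp [T]) (by simp [T]) (by simp [T]) fun a => ?_⟩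
  have heq : ∀ {k l}, (∀ b, perp h x o e k b = perp h x o e l b) →
      perpRow h x o e k = perpRow h x o e l := by
    intro k l hkl
    funext b
    cases b with
    | none => rfl
    | some b => exact hkl b
  by_cases ha : ∃ b, perp h x o e a b ≠ 0
  · obtain ⟨b, hab⟩ := ha
    rcases perp_ne_zero_or hh hs h0 hoe hH (inner hab) hij with hia | hja
    · rw [heq (perp_eq_perp_of_ne_zero hh h3 hs h0 hoe hH (inner hij) hij hia)]
      exact hT j (by simp [T])
    · rw [heq (perp_eq_perp_of_ne_zero hh h3 hs h0 hoe hH (inner hji) hji hja)]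
      exact hT i (by simp [T])
  · push Not at ha
    rw [hzero a ha, smul_zero]
    exact Submodule.zero_mem _

end Flat

/-! ### Thin triangles over a local domain -/

section Thin

variable {O ι : Type*} [CommRing O] [IsDomain O] [IsLocalRing O] {h ε : O} {x : ι → ι → O}

theorem cmMatrix_map {R S ι : Type*} [CommRing R] [CommRing S] (f : R →+* S) (x : ι → ι → R) :
    (cmMatrix x).map f = cmMatrix fun a b => f (x a b) := by
  ext (_ | a) (_ | b) <;> simp [cmMatrix]

theorem map_heron {R S : Type*} [CommRing R] [CommRing S] (f : R →+* S) (x y z : R) :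
    f (heron x y z) = heron (f x) (f y) (f z) := by
  simp only [heron, map_sub, map_mul, map_add, map_pow, map_ofNat]

/-- When the squared triangle areas are unit multiples of `ε`, at most one vertex is infinitely
close to `o`: two such vertices would form with `o` a triangle of smaller area. -/
theorem eq_of_not_isUnit (hh : 2 * h = 1) (hs : ∀ a b, x a b = x b a) (h0 : ∀ a, x a a = 0)
    (hε0 : ε ≠ 0) (hε : ¬ IsUnit ε)
    (hH : ∀ a b c, a ≠ b → b ≠ c → c ≠ a →
      ∃ u, IsUnit u ∧ heron (x a b) (x b c) (x c a) = ε * u) {o e a b : ι} (hoe : x o e = 1)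
    (hao : a ≠ o) (hbo : b ≠ o) (ha : ¬ IsUnit (x o a)) (hb : ¬ IsUnit (x o b)) : a = b := by
  by_contra hab
  have hne : o ≠ e := fun h => by rw [h, h0] at hoe; exact zero_ne_one hoe
  have hae : a ≠ e := fun h => ha (by rw [h, hoe]; exact isUnit_one)
  have hbe : b ≠ e := fun h => hb (by rw [h, hoe]; exact isUnit_one)
  have diag : ∀ a, a ≠ o → a ≠ e → ∃ α, perp h x o e a a = ε * α := by
    intro a hao hae
    obtain ⟨u, -, hu⟩ := hH o e a hne (Ne.symm hae) hao
    rw [heron_axis hh hs h0 hoe] at hu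
    exact ⟨h ^ 2 * u, by
      linear_combination h ^ 2 * hu - (2 * h + 1) * perp h x o e a a * hh⟩
  obtain ⟨α, hα⟩ := diag a hao hae
  obtain ⟨β, hβ⟩ := diag b hbo hbe
  obtain ⟨u, hu, hu'⟩ := hH o a b (Ne.symm hao) hab hbo
  obtain ⟨v, -, hv'⟩ := hH e a b (Ne.symm hae) hab hbe
  have small : ∀ a α, perp h x o e a a = ε * α → ¬ IsUnit (x o a) →
      IsLocalRing.residue O (axial h x o e a) = 0 := by
    intro a α hα ha
    rw [← mem_nonunits_iff, ← IsLocalRing.mem_maximalIdeal, ← IsLocalRing.residue_eq_zero_iff,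
      sqDist_left hh hs h0 hoe, hα, map_add, map_mul, map_pow] at ha
    have : IsLocalRing.residue O ε = 0 :=
      (IsLocalRing.residue_eq_zero_iff _).2 ((IsLocalRing.mem_maximalIdeal _).2 hε)
    rw [this, zero_mul, add_zero] at ha
    exact pow_eq_zero_iff (two_ne_zero) |>.1 ha
  have hsa := small a α hα ha
  have hsb := small b β hβ hb
  rw [heron_left hh hs h0 hoe, hα, hβ] at hu'
  rw [heron_right hh hs h0 hoe, hα, hβ] at hv'
  set p := perp h x o e a b
  set s := axial h x o e a
  set t := axial h x o e b
  have hun : IsUnit (1 - s - t) := by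
    rw [← IsLocalRing.residue_ne_zero_iff_isUnit, map_sub, map_sub, hsa, hsb]
    simp
  have hp : ε ∣ p * (1 - s - t) := by
    refine ⟨h ^ 3 * (u - v) - 4 * h ^ 3 * (s ^ 2 * β + t ^ 2 * α - (1 - s) ^ 2 * β
      - (1 - t) ^ 2 * α), ?_⟩
    have h8 : 8 * h ^ 3 = 1 := by linear_combination (4 * h ^ 2 + 2 * h + 1) * hh
    linear_combination h ^ 3 * hu' - h ^ 3 * hv' - p * (1 - s - t) * h8
  obtain ⟨γ, hγ⟩ := (hun.dvd_mul_right).1 hp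
  have hu2 : u = 4 * (s ^ 2 * β + t ^ 2 * α + ε * α * β - 2 * s * t * γ - ε * γ ^ 2) := by
    apply mul_left_cancel₀ hε0
    rw [← hu', hγ]; ring
  have hε' : IsLocalRing.residue O ε = 0 :=
    (IsLocalRing.residue_eq_zero_iff _).2 ((IsLocalRing.mem_maximalIdeal _).2 hε)
  refine (IsLocalRing.residue_ne_zero_iff_isUnit _).2 hu ?_
  rw [hu2]
  simp [hsa, hsb, hε']

/-- Among at least five vertices, some vertex is infinitely close to neither `o` nor `e`. -/
theorem exists_isUnit_isUnit [Fintype ι] (hh : 2 * h = 1) (hs : ∀ a b, x a b = x b a)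
    (h0 : ∀ a, x a a = 0) (hε0 : ε ≠ 0) (hε : ¬ IsUnit ε)
    (hH : ∀ a b c, a ≠ b → b ≠ c → c ≠ a →
      ∃ u, IsUnit u ∧ heron (x a b) (x b c) (x c a) = ε * u) {o e : ι} (hoe : x o e = 1)
    (hcard : 5 ≤ Fintype.card ι) : ∃ c, IsUnit (x o c) ∧ IsUnit (x e c) := by
  classical
  by_contra! hcon
  let S : ι → Finset ι := fun o => Finset.univ.filter fun c => c ≠ o ∧ ¬ IsUnit (x o c)
  have hS : ∀ o e, x o e = 1 → (S o).card ≤ 1 := by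
    intro o e hoe
    refine Finset.card_le_one.2 fun a ha b hb => ?_
    simp only [S, Finset.mem_filter, Finset.mem_univ, true_and] at ha hb
    exact eq_of_not_isUnit hh hs h0 hε0 hε hH hoe ha.1 hb.1 ha.2 hb.2
  have hsub : (Finset.univ : Finset ι) ⊆ {o, e} ∪ (S o ∪ S e) := by
    intro c _
    by_cases hco : c = o
    · simp [hco]
    by_cases hce : c = e
    · simp [hce]
    by_cases h1 : IsUnit (x o c)
    · simp [S, hce, hcon c h1]
    · simp [S, hco, h1]
  have h1 := Finset.card_le_card hsub
  have h2 := Finset.card_union_le ({o, e} : Finset ι) (S o ∪ S e)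
  have h3 := Finset.card_union_le (S o) (S e)
  have h4 := hS o e hoe
  have h5 := hS e o (hs o e ▸ hoe)
  have h6 : ({o, e} : Finset ι).card ≤ 2 := Finset.card_le_two
  rw [Finset.card_univ] at h1
  omega

/-- If the largest squared edge length is `1` and the squared areas of all triangles are unit
multiples of `ε`, then the bordered determinant vanishes to high order in `ε`. -/
theorem pow_dvd_det_cmMatrix [Fintype ι] [DecidableEq ι] (hh : 2 * h = 1) (h3 : IsUnit (3 : O))
    (hs : ∀ a b, x a b = x b a) (h0 : ∀ a, x a a = 0) (hε0 : ε ≠ 0) (hε : ¬ IsUnit ε)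
    (hH : ∀ a b c, a ≠ b → b ≠ c → c ≠ a →
      ∃ u, IsUnit u ∧ heron (x a b) (x b c) (x c a) = ε * u) {o e : ι} (hoe : x o e = 1)
    (hcard : 5 ≤ Fintype.card ι) {k : ℕ} (hk : k + 4 ≤ Fintype.card ι) :
    ε ^ k ∣ (cmMatrix x).det := by
  let q := Ideal.Quotient.mk (Ideal.span {ε})
  have hnt : Nontrivial (O ⧸ Ideal.span {ε}) := by
    rw [Ideal.Quotient.nontrivial_iff, Ne, Ideal.span_singleton_eq_top]
    exact hε
  have : IsLocalRing (O ⧸ Ideal.span {ε}) :=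
    IsLocalRing.of_surjective' q Ideal.Quotient.mk_surjective
  have hqs : ∀ a b, q (x a b) = q (x b a) := fun a b => by rw [hs]
  have hq0 : ∀ a, q (x a a) = 0 := fun a => by rw [h0, map_zero]
  have hqoe : q (x o e) = 1 := by rw [hoe, map_one]
  have hqh : 2 * q h = 1 := by rw [← map_ofNat q 2, ← map_mul, hh, map_one]
  have hqH : ∀ a b c, heron (q (x a b)) (q (x b c)) (q (x c a)) = 0 := by
    intro a b c
    by_cases hab : a = b
    · rw [hab, hs c b]; simp only [hq0, heron]; ring
    by_cases hbc : b = c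
    · rw [hbc, hs c a]; simp only [hq0, heron]; ring
    by_cases hca : c = a
    · rw [hca, hs b a]; simp only [hq0, heron]; ring
    obtain ⟨u, -, hu⟩ := hH a b c hab hbc hca
    rw [← map_heron, hu, map_mul, Ideal.Quotient.eq_zero_iff_mem.2 (Ideal.mem_span_singleton_self ε),
      zero_mul]
  obtain ⟨c, hc1, hc2⟩ := exists_isUnit_isUnit hh hs h0 hε0 hε hH hoe hcard
  have h3q : IsUnit (3 : O ⧸ Ideal.span {ε}) := by
    rw [← map_ofNat q 3]; exact h3.map q
  obtain ⟨T, hT, hspan⟩ := exists_rows_span_of_flat (x := fun a b => q (x a b)) hqh h3q hqs hq0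
    hqoe hqH ⟨c, isInner_of_isUnit hqh hqs hq0 hqoe hqH (hc1.map q) (hc2.map q)⟩
  refine pow_dvd_det_of_rows_mem_span _ ε T (fun a _ => ?_) (k := k) ?_
  · rw [cmMatrix_map]; exact hspan a
  · rw [Fintype.card_option]; omega

end Thin

/-! ### The Cayley–Menger determinant of a face -/

section CayleyMenger

theorem mul_det_cmMatrix_smul {R ι : Type*} [CommRing R] [Fintype ι] [DecidableEq ι]
    (x : ι → ι → R) (c : R) :
    c * (cmMatrix fun a b => c * x a b).det = c ^ (Fintype.card ι) * (cmMatrix x).det := by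
  let r : Option ι → R := fun a => a.elim 1 fun _ => c
  let l : Option ι → R := fun a => a.elim c fun _ => 1
  have e : (Matrix.of fun a b => l b * cmMatrix (fun a b => c * x a b) a b) =
      Matrix.of fun a b => r a * cmMatrix x a b := by
    ext (_ | a) (_ | b) <;> simp [l, r, cmMatrix]
  have h1 := Matrix.det_mul_row l (cmMatrix fun a b => c * x a b)
  rw [e, Matrix.det_mul_column] at h1
  simpa [l, r, Fintype.prod_option] using h1.symm

theorem cayleyMengerMatrix_eq {n k : ℕ} (F : Face n k) :
    cayleyMengerMatrix F = cmMatrix fun i j : F.1 => len i.1 j.1 ^ 2 := by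
  ext (_ | a) (_ | b) <;> simp [cmMatrix, cayleyMengerMatrix]

theorem det_cmMatrix_equiv {R ι κ : Type*} [CommRing R] [Fintype ι] [DecidableEq ι] [Fintype κ]
    [DecidableEq κ] (e : κ ≃ ι) (x : ι → ι → R) :
    (cmMatrix fun a b => x (e a) (e b)).det = (cmMatrix x).det := by
  rw [← Matrix.det_submatrix_equiv_self e.optionCongr (cmMatrix x)]
  congr 1
  ext (_ | a) (_ | b) <;> simp [cmMatrix]

theorem det_cmMatrix_fin_three {R : Type*} [CommRing R] (x : Fin 3 → Fin 3 → R)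
    (hs : ∀ a b, x a b = x b a) (h0 : ∀ a, x a a = 0) :
    (cmMatrix x).det = - heron (x 0 1) (x 1 2) (x 2 0) := by
  rw [← Matrix.det_submatrix_equiv_self (finSuccEquiv 3) (cmMatrix x)]
  have e : (cmMatrix x).submatrix (finSuccEquiv 3) (finSuccEquiv 3) =
      !![0, 1, 1, 1; 1, 0, x 0 1, x 2 0; 1, x 0 1, 0, x 1 2; 1, x 2 0, x 1 2, 0] := by
    ext i j
    refine Fin.cases ?_ (fun i => ?_) i <;> refine Fin.cases ?_ (fun j => ?_) j
    · simp [cmMatrix]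
    · rw [Matrix.submatrix_apply, finSuccEquiv_succ, finSuccEquiv_zero]
      fin_cases j <;> simp [cmMatrix]
    · rw [Matrix.submatrix_apply, finSuccEquiv_succ, finSuccEquiv_zero]
      fin_cases i <;> simp [cmMatrix]
    · rw [Matrix.submatrix_apply, finSuccEquiv_succ, finSuccEquiv_succ]
      fin_cases i <;> fin_cases j <;> simp [cmMatrix, h0, hs 1 0, hs 2 1, hs 0 2]
  rw [e]
  simp [Matrix.det_succ_row_zero, Fin.sum_univ_succ, heron, Fin.succAbove]
  ring

theorem len_comm {n : ℕ} (i j : Fin (n + 1)) : len i j = len j i := by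
  unfold len
  by_cases h : i = j
  · simp [h]
  · rw [dif_neg h, dif_neg (Ne.symm h)]
    congr 2
    exact Sym2.eq_swap

theorem len_self {n : ℕ} (i : Fin (n + 1)) : len i i = 0 := dif_pos rfl

/-- Heron's formula, for a triangle with vertices in any order. -/
theorem sqVolPoly_eq_heron {n : ℕ} (F : Face n 2) (e : Fin 3 ≃ F.1) :
    sqVolPoly F = MvPolynomial.C (1 / 16) *
      heron (len (e 0).1 (e 1).1 ^ 2) (len (e 1).1 (e 2).1 ^ 2) (len (e 2).1 (e 0).1 ^ 2) := by
  rw [sqVolPoly, cayleyMengerMatrix_eq, ← det_cmMatrix_equiv e, det_cmMatrix_fin_three]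
  · rw [mul_neg, ← neg_mul, ← map_neg]
    congr 2
    norm_num
  · intro a b; rw [len_comm]
  · intro a; rw [len_self]; simp

theorem exists_equiv_of_face {n : ℕ} (F : Face n 2) : Nonempty (Fin 3 ≃ F.1) :=
  ⟨(F.1.equivFinOfCardEq F.2).symm⟩

/-- The face with three given distinct vertices, enumerated in the given order. -/
theorem exists_face_equiv {n : ℕ} {a b c : Fin (n + 1)} (hab : a ≠ b) (hbc : b ≠ c)
    (hca : c ≠ a) : ∃ (F : Face n 2) (e : Fin 3 ≃ F.1),
      (e 0).1 = a ∧ (e 1).1 = b ∧ (e 2).1 = c := by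
  have hcard : ({a, b, c} : Finset (Fin (n + 1))).card = 2 + 1 :=
    Finset.card_eq_three.2 ⟨a, b, c, hab, Ne.symm hca, hbc, rfl⟩
  let f : Fin 3 → ({a, b, c} : Finset (Fin (n + 1))) :=
    ![⟨a, by simp⟩, ⟨b, by simp⟩, ⟨c, by simp⟩]
  have hf : Function.Bijective f := by
    rw [Fintype.bijective_iff_injective_and_card]
    refine ⟨?_, by rw [Fintype.card_coe, hcard, Fintype.card_fin]⟩
    intro i j hij
    fin_cases i <;> fin_cases j <;> simp_all [f, Subtype.ext_iff]
  exact ⟨⟨{a, b, c}, hcard⟩, Equiv.ofBijective f hf, rfl, rfl, rfl⟩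

end CayleyMenger

/-! ### Finiteness of the volume in a valuation ring -/

section Valuation

/-- If every triangle has a squared area that is a unit of the valuation ring, then the bordered
determinant of at least seven points lies in the valuation ring. -/
theorem det_cmMatrix_mem_valuationSubring {K ι : Type*} [Field K] [CharZero K] [Fintype ι]
    [DecidableEq ι] (O : ValuationSubring K) (hQ : ∀ q : ℚ, (q : K) ∈ O) (X : ι → ι → K)
    (hs : ∀ a b, X a b = X b a) (h0 : ∀ a, X a a = 0)
    (hH : ∀ a b c, a ≠ b → b ≠ c → c ≠ a → heron (X a b) (X b c) (X c a) ≠ 0 ∧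
      heron (X a b) (X b c) (X c a) ∈ O ∧ (heron (X a b) (X b c) (X c a))⁻¹ ∈ O)
    (hcard : 7 ≤ Fintype.card ι) : (cmMatrix X).det ∈ O := by
  have hne : Nonempty ι := Fintype.card_pos_iff.1 (by omega)
  have lift_det : ∀ x : ι → ι → O, (cmMatrix fun a b => (x a b : K)).det =
      ((cmMatrix x).det : O) := by
    intro x
    have := RingHom.map_det O.subtype (cmMatrix x)
    rw [RingHom.mapMatrix_apply, cmMatrix_map] at this
    exact this.symm
  obtain ⟨⟨o, e⟩, -, hmax⟩ := Finset.exists_max_image (Finset.univ : Finset (ι × ι))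
    (fun p => O.valuation (X p.1 p.2)) Finset.univ_nonempty
  have hmax : ∀ a b, O.valuation (X a b) ≤ O.valuation (X o e) :=
    fun a b => hmax (a, b) (Finset.mem_univ _)
  by_cases hoe : X o e ∈ O
  · have hX : ∀ a b, X a b ∈ O := fun a b => by
      rw [← O.valuation_le_one_iff] at hoe ⊢
      exact (hmax a b).trans hoe
    have := lift_det fun a b => ⟨X a b, hX a b⟩
    simp only at this
    rw [this]
    exact SetLike.coe_mem _
  have hc0 : X o e ≠ 0 := fun h => hoe (h ▸ O.zero_mem)
  have hδ : (X o e)⁻¹ ∈ O := (O.mem_or_inv_mem _).resolve_left hoe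
  have hx : ∀ a b, X a b / X o e ∈ O := fun a b => by
    rw [← O.valuation_le_one_iff, map_div₀]
    exact div_le_one_of_le₀ (hmax a b) zero_le
  let x : ι → ι → O := fun a b => ⟨X a b / X o e, hx a b⟩
  let δ : O := ⟨(X o e)⁻¹, hδ⟩
  have unit_of : ∀ y (hy : y ∈ O), y ≠ 0 → y⁻¹ ∈ O → IsUnit (⟨y, hy⟩ : O) := fun y hy h0 hy' =>
    IsUnit.of_mul_eq_one ⟨y⁻¹, hy'⟩ (Subtype.ext (mul_inv_cancel₀ h0))
  have hdvd : (δ ^ 2) ^ (Fintype.card ι - 4) ∣ (cmMatrix x).det := by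
    refine pow_dvd_det_cmMatrix (h := ⟨2⁻¹, by simpa using hQ 2⁻¹⟩) (o := o) (e := e)
      (Subtype.ext (mul_inv_cancel₀ two_ne_zero))
      (unit_of 3 (by exact_mod_cast hQ 3) three_ne_zero (by simpa using hQ 3⁻¹)) ?_ ?_ ?_ ?_ ?_ ?_
      (by omega) (by omega)
    · intro a b; exact Subtype.ext (by simp only [x, hs a b])
    · intro a; exact Subtype.ext (by simp [x, h0])
    · intro h
      exact hc0 (by simpa [δ] using congrArg Subtype.val h)
    · intro h
      obtain ⟨y, hy⟩ := isUnit_iff_exists_inv.1 ((isUnit_pow_iff two_ne_zero).1 h)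
      have : X o e = y := by
        have := congrArg Subtype.val hy
        simp only [δ, MulMemClass.coe_mul, OneMemClass.coe_one] at this
        field_simp at this
        exact this.symm
      exact hoe (this ▸ y.2)
    · intro a b c hab hbc hca
      obtain ⟨h1, h2, h3⟩ := hH a b c hab hbc hca
      refine ⟨⟨_, h2⟩, unit_of _ h2 h1 h3, O.subtype_injective ?_⟩
      rw [map_heron, map_mul, map_pow]
      simp only [O.coe_subtype, x, δ, heron]
      field_simp
    · exact Subtype.ext (div_self hc0)
  obtain ⟨w, hw⟩ := hdvd
  obtain ⟨m, hm⟩ := Nat.exists_eq_add_of_le hcard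
  have key := mul_det_cmMatrix_smul (fun a b => (x a b : K)) (X o e)
  rw [lift_det, hw] at key
  have hX : (fun a b => X o e * (x a b : K)) = X := by
    funext a b
    exact mul_div_cancel₀ _ hc0
  rw [hX, hm] at key
  have : (cmMatrix X).det = ((δ ^ m * w : O) : K) := by
    apply mul_left_cancel₀ hc0
    rw [key]
    have h7 : 7 + m - 4 = m + 3 := by omega
    have hcδ : X o e * (δ : K) = 1 := mul_inv_cancel₀ hc0
    rw [h7]
    push_cast
    have : X o e ^ (7 + m) * (((δ : K) ^ 2) ^ (m + 3) * (w : K)) =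
      X o e * (X o e * (δ : K)) ^ (m + 6) * ((δ : K) ^ m * w) := by ring
    rw [this, hcδ]; ring
  rw [this]
  exact SetLike.coe_mem _

end Valuation

/-! ### Integrality of the volume -/

section Field

variable {n : ℕ}

/-- The squared edge length `ℓ_{ab}²` in `𝔽`. -/
noncomputable def sqLen (a b : Fin (n + 1)) : FF n := algebraMap (LengthPoly n) (FF n) (len a b ^ 2)

theorem algebraMap_C (q : ℚ) :
    algebraMap (LengthPoly n) (FF n) (MvPolynomial.C q) = algebraMap ℚ (FF n) q :=
  RingHom.congr_fun (RingHom.ext_rat ((algebraMap (LengthPoly n) (FF n)).comp MvPolynomial.C)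
    (algebraMap ℚ (FF n))) q

theorem algebraMap_lengthPoly_injective :
    Function.Injective (algebraMap (LengthPoly n) (FF n)) := by
  rw [IsScalarTower.algebraMap_eq (LengthPoly n) (FractionRing (LengthPoly n)) (FF n)]
  exact (algebraMap (FractionRing (LengthPoly n)) (FF n)).injective.comp
    (IsFractionRing.injective _ _)

theorem sqVol_eq_algebraMap {k : ℕ} (F : Face n k) :
    sqVol F = algebraMap (LengthPoly n) (FF n) (sqVolPoly F) :=
  (IsScalarTower.algebraMap_apply _ _ _ _).symm

theorem sqVol_eq_heron (F : Face n 2) (e : Fin 3 ≃ F.1) :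
    sqVol F = (1 / 16 : ℚ) • heron (sqLen (e 0).1 (e 1).1) (sqLen (e 1).1 (e 2).1)
      (sqLen (e 2).1 (e 0).1) := by
  rw [sqVol_eq_algebraMap, sqVolPoly_eq_heron F e, map_mul, map_heron, Algebra.smul_def,
    algebraMap_C]
  rfl

theorem sqVol_univ : V n ^ 2 =
    ((-1) ^ (n + 1) / (2 ^ n * (n.factorial : ℚ) ^ 2)) •
      (cmMatrix (sqLen : Fin (n + 1) → Fin (n + 1) → FF n)).det := by
  rw [V, faceVol_sq, sqVol_eq_algebraMap, sqVolPoly, map_mul, cayleyMengerMatrix_eq,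
    ← det_cmMatrix_equiv (Equiv.subtypeUnivEquiv (p := (· ∈ Finset.univ))
      (fun x : Fin (n + 1) => Finset.mem_univ x)).symm, RingHom.map_det, RingHom.mapMatrix_apply,
    cmMatrix_map, Algebra.smul_def,
    algebraMap_C]
  rfl

theorem faceVol_ne_zero (F : Face n 2) : faceVol F ≠ 0 := by
  intro h
  have h1 := faceVol_sq F
  rw [h, sqVol_eq_algebraMap, zero_pow two_ne_zero, eq_comm,
    map_eq_zero_iff _ algebraMap_lengthPoly_injective] at h1
  obtain ⟨e⟩ := exists_equiv_of_face F
  rw [sqVolPoly_eq_heron F e] at h1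
  -- The regular simplex has faces of non-zero area.
  have h2 := congrArg (MvPolynomial.eval fun _ => (1 : ℚ)) h1
  have hl : ∀ i j, i ≠ j → MvPolynomial.eval (fun _ => (1 : ℚ)) (len (e i).1 (e j).1) = 1 := by
    intro i j hij
    have : (e i).1 ≠ (e j).1 := fun h => hij (e.injective (Subtype.ext h))
    rw [len, dif_neg this, MvPolynomial.eval_X]
  rw [map_mul, map_heron] at h2
  simp only [map_pow, hl 0 1 (by decide), hl 1 2 (by decide), hl 2 0 (by decide)] at h2
  norm_num [heron] at h2

theorem V_mem_of_laurentAlg_le (hn : 6 ≤ n) (O : ValuationSubring (FF n))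
    (hO : ∀ x ∈ laurentAlg n 2, x ∈ O) : V n ∈ O := by
  have hQ : ∀ q : ℚ, (q : FF n) ∈ O := fun q => hO _ (by
    rw [← eq_ratCast (algebraMap ℚ (FF n)) q]
    exact Subalgebra.algebraMap_mem _ q)
  have hA : ∀ F : Face n 2, faceVol F ∈ O := fun F =>
    hO _ (Algebra.subset_adjoin (Or.inl ⟨F, rfl⟩))
  have hA' : ∀ F : Face n 2, (faceVol F)⁻¹ ∈ O := fun F =>
    hO _ (Algebra.subset_adjoin (Or.inr ⟨F, rfl⟩))
  have hdet : (cmMatrix (sqLen : Fin (n + 1) → Fin (n + 1) → FF n)).det ∈ O := by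
    refine det_cmMatrix_mem_valuationSubring O hQ _ ?_ ?_ ?_ ?_
    · intro a b; rw [sqLen, len_comm, sqLen]
    · intro a; simp [sqLen, len_self]
    · intro a b c hab hbc hca
      obtain ⟨F, e, rfl, rfl, rfl⟩ := exists_face_equiv hab hbc hca
      have h := sqVol_eq_heron F e
      have h16 : heron (sqLen (e 0).1 (e 1).1) (sqLen (e 1).1 (e 2).1) (sqLen (e 2).1 (e 0).1) =
          ((16 : ℚ) : FF n) * faceVol F ^ 2 := by
        rw [faceVol_sq, h, Algebra.smul_def, eq_ratCast, ← mul_assoc, ← Rat.cast_mul]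
        norm_num
      rw [h16]
      refine ⟨mul_ne_zero (by norm_num) (pow_ne_zero _ (faceVol_ne_zero F)),
        O.mul_mem _ _ (hQ _) (pow_mem (hA F) 2), ?_⟩
      rw [mul_inv, ← Rat.cast_inv, ← inv_pow]
      exact O.mul_mem _ _ (hQ _) (pow_mem (hA' F) 2)
    · rw [Fintype.card_fin]; omega
  have hV2 : V n ^ 2 ∈ O := by
    rw [sqVol_univ, Algebra.smul_def, eq_ratCast]
    exact O.mul_mem _ _ (hQ _) hdet
  rw [← O.valuation_le_one_iff] at hV2 ⊢
  rw [map_pow] at hV2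
  exact (pow_le_one_iff two_ne_zero).1 hV2

/-- The volume is integral, since it lies in all valuation rings over the algebra. -/
theorem isIntegral_V (hn : 6 ≤ n) : IsIntegral (laurentAlg n 2) (V n) := by
  by_contra hV
  let B := (integralClosure (laurentAlg n 2) (FF n)).toSubring
  have hB : IsIntegrallyClosedIn B (FF n) :=
    inferInstanceAs (IsIntegrallyClosedIn (integralClosure (laurentAlg n 2) (FF n)) (FF n))
  obtain ⟨O, hBO, hVO⟩ := Subring.exists_le_valuationSubring_of_isIntegrallyClosedIn
    (R := B) (x := V n) hV
  refine hVO (V_mem_of_laurentAlg_le hn O fun x hx => hBO ?_)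
  exact isIntegral_algebraMap (R := laurentAlg n 2) (x := ⟨x, hx⟩)

end Field

/-! ### Areas of real simplices -/

section Measure

/-- A simplex has positive and finite Euclidean measure in its own dimension: it is the image of
a standard simplex under an injective affine map. -/
theorem euclideanHausdorffMeasure_convexHull {E : Type*} [NormedAddCommGroup E]
    [InnerProductSpace ℝ E] [FiniteDimensional ℝ E] [MeasurableSpace E] [BorelSpace E] {k : ℕ}
    (P : Fin (k + 1) → E) (hP : AffineIndependent ℝ P) :
    (μHE[k] : Measure E) (convexHull ℝ (Set.range P)) ≠ 0 ∧
      (μHE[k] : Measure E) (convexHull ℝ (Set.range P)) ≠ ⊤ := by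
  let U := EuclideanSpace ℝ (Fin k)
  let v : Fin k → E := fun i => P i.succ - P 0
  have hv : LinearIndependent ℝ v := by
    have := (affineIndependent_iff_linearIndependent_vsub ℝ P 0).1 hP
    exact this.comp (fun i : Fin k => ⟨i.succ, Fin.succ_ne_zero i⟩)
      fun i j hij => Fin.succ_injective _ (Subtype.ext_iff.1 hij)
  let f : U →ₗ[ℝ] E := Fintype.linearCombination ℝ v ∘ₗ
    (WithLp.linearEquiv 2 ℝ (Fin k → ℝ)).toLinearMap
  have hf : Function.Injective f :=
    hv.fintypeLinearCombination_injective.comp (WithLp.linearEquiv 2 ℝ _).injective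
  let q : Fin (k + 1) → U := Fin.cons 0 fun i => EuclideanSpace.single i (1 : ℝ)
  have hfq : ∀ i, f (q i) + P 0 = P i := by
    intro i
    refine Fin.cases ?_ (fun i => ?_) i
    · simp [q]
    · have : f (q i.succ) = v i :=
        (Fintype.linearCombination_apply_single ℝ v i 1).trans (one_smul _ _)
      rw [this, sub_add_cancel]
  have himage : convexHull ℝ (Set.range P) =
      (fun x => x + P 0) '' (f '' convexHull ℝ (Set.range q)) := by
    have := (f.toAffineMap + AffineMap.const ℝ U (P 0)).image_convexHull (Set.range q)
    rw [Set.image_image]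
    refine Eq.trans ?_ this.symm
    rw [← Set.range_comp]
    congr 2
    funext i
    exact (hfq i).symm
  have hspan : affineSpan ℝ (Set.range q) = ⊤ := by
    rw [AffineSubspace.affineSpan_eq_top_iff_vectorSpan_eq_top_of_nonempty ℝ U U
      (Set.range_nonempty q), eq_top_iff, ← (EuclideanSpace.basisFun (Fin k) ℝ).toBasis.span_eq,
      Submodule.span_le]
    rintro _ ⟨i, rfl⟩
    have := vsub_mem_vectorSpan ℝ (Set.mem_range_self (f := q) i.succ) (Set.mem_range_self 0)
    simpa [q] using this
  have hpos : (volume : Measure U) (convexHull ℝ (Set.range q)) ≠ 0 :=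
    (Measure.measure_pos_of_nonempty_interior _
      (interior_convexHull_nonempty_iff_affineSpan_eq_top.2 hspan)).ne'
  have hfin : (volume : Measure U) (convexHull ℝ (Set.range q)) ≠ ⊤ :=
    ((Set.finite_range q).isCompact_convexHull ℝ).measure_lt_top.ne
  have hmeas : (μHE[k] : Measure E) (convexHull ℝ (Set.range P)) =
      ENNReal.ofReal f.normDet * volume (convexHull ℝ (Set.range q)) := by
    have h := f.euclideanHausdorffMeasure_image_eq_normDet_mul_volume (convexHull ℝ (Set.range q))
    rw [finrank_euclideanSpace_fin] at h
    rw [← h, himage]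
    exact (isometry_add_right (P 0)).euclideanHausdorffMeasure_image _
  have hdet : f.normDet ≠ 0 := by
    rw [Ne, LinearMap.normDet_eq_zero_iff_ker_ne_bot, not_not]
    exact LinearMap.ker_eq_bot.2 hf
  rw [hmeas]
  refine ⟨mul_ne_zero ?_ hpos, ENNReal.mul_ne_top ENNReal.ofReal_ne_top hfin⟩
  rw [Ne, ENNReal.ofReal_eq_zero, not_le]
  exact lt_of_le_of_ne f.normDet_nonneg (Ne.symm hdet)

theorem realFaceVol_ne_zero {n k : ℕ} (Δ : Affine.Simplex ℝ (EuclideanSpace ℝ (Fin n)) n)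
    (F : Face n k) : realFaceVol Δ F ≠ 0 := by
  let e : Fin (k + 1) ≃ F.1 := (F.1.equivFinOfCardEq F.2).symm
  have hind : AffineIndependent ℝ fun i => Δ.points (e i).1 :=
    Δ.independent.comp_embedding (e.toEmbedding.trans (Function.Embedding.subtype _))
  have hr : Set.range (fun i => Δ.points (e i).1) = Δ.points '' (F.1 : Set _) := by
    ext y
    constructor
    · rintro ⟨i, rfl⟩
      exact ⟨_, (e i).2, rfl⟩
    · rintro ⟨a, ha, rfl⟩
      exact ⟨e.symm ⟨a, ha⟩, by simp⟩
  obtain ⟨h1, h2⟩ := euclideanHausdorffMeasure_convexHull _ hind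
  rw [hr] at h1 h2
  exact (Measure.real_def _ _).trans_ne (ENNReal.toReal_ne_zero.2 ⟨h1, h2⟩)

theorem laurentAlg_le_regularAlg (n : ℕ) : laurentAlg n 2 ≤ regularAlg n 2 := by
  refine Algebra.adjoin_le ?_
  rintro _ (⟨F, rfl⟩ | ⟨F, rfl⟩)
  · exact ⟨MvPolynomial.X F, 1, fun Δ => by simp, by simp, by simp⟩
  · refine ⟨1, MvPolynomial.X F, fun Δ => ?_, ?_, by simp⟩
    · rw [MvPolynomial.aeval_X]; exact realFaceVol_ne_zero Δ F
    · rw [MvPolynomial.aeval_X]; exact faceVol_ne_zero F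

end Measure

/-! ### Specialisations and failure of integrality -/

section Specialization

/-- A homomorphism to an algebraically closed field extends along an integral extension. -/
theorem exists_ringHom_extension {R S K : Type*} [CommRing R] [CommRing S] [Algebra R S]
    [Algebra.IsIntegral R S] (hinj : Function.Injective (algebraMap R S)) [Field K]
    [IsAlgClosed K] (g : R →+* K) : ∃ φ : S →+* K, ∀ r, φ (algebraMap R S r) = g r := by
  have hP : (RingHom.ker g).IsPrime := RingHom.ker_isPrime g
  obtain ⟨Q, hQ, hQP⟩ := (Ideal.exists_ideal_over_prime_of_isIntegral (S := S) (RingHom.ker g) ⊥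
    (by rw [← RingHom.ker_eq_comap_bot, (RingHom.injective_iff_ker_eq_bot _).1 hinj]
        exact bot_le)).imp fun Q h => h.2
  have hQ' : (Q.comap (algebraMap R S)).IsPrime := by rw [hQP]; exact hP
  let g' : R ⧸ Q.comap (algebraMap R S) →+* K :=
    Ideal.Quotient.lift _ g fun a ha => by rw [hQP] at ha; exact ha
  let _ : Algebra (R ⧸ Q.comap (algebraMap R S)) K := g'.toAlgebra
  have hg' : Function.Injective (algebraMap (R ⧸ Q.comap (algebraMap R S)) K) := by
    rw [injective_iff_map_eq_zero]
    intro a ha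
    obtain ⟨r, rfl⟩ := Ideal.Quotient.mk_surjective a
    rw [Ideal.Quotient.eq_zero_iff_mem, hQP]
    exact ha
  have : Module.IsTorsionFree (R ⧸ Q.comap (algebraMap R S)) K :=
    Module.isTorsionFree_iff_algebraMap_injective.2 hg'
  have : Module.IsTorsionFree (R ⧸ Q.comap (algebraMap R S)) (S ⧸ Q) :=
    Module.isTorsionFree_iff_algebraMap_injective.2 Ideal.algebraMap_quotient_injective
  let ψ : S ⧸ Q →ₐ[R ⧸ Q.comap (algebraMap R S)] K := IsAlgClosed.lift
  exact ⟨ψ.toRingHom.comp (Ideal.Quotient.mk Q), fun r =>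
    ψ.commutes (Ideal.Quotient.mk _ r)⟩

/-- An element `v` is not integral over the algebra generated by finitely many elements `A i` and
their inverses if there are specialisations keeping all `A i` away from `0` and `∞` on which `v`
is unbounded. -/
theorem not_isIntegral_of_unbounded {B K ι : Type*} [CommRing B] [Field K] [Algebra ℚ B]
    [Algebra ℚ K] [Fintype ι] (j : B →+* K) (hj : Function.Injective j) (A : ι → B)
    (hA : ∀ i, A i ≠ 0) (v : B) (Φ : Set (B →+* ℂ)) {c C : ℝ} (hc : 0 < c)
    (hlow : ∀ φ ∈ Φ, ∀ i, c ≤ ‖φ (A i)‖) (hup : ∀ φ ∈ Φ, ∀ i, ‖φ (A i)‖ ≤ C)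
    (hv : ∀ M : ℝ, ∃ φ ∈ Φ, M < ‖φ v‖) :
    ¬ IsIntegral (Algebra.adjoin ℚ
      (Set.range (fun i => j (A i)) ∪ Set.range (fun i => (j (A i))⁻¹))) (j v) := by
  classical
  rintro ⟨p, hp, hpv⟩
  let P : B := ∏ i, A i
  -- After clearing denominators, each coefficient is bounded on `Φ`.
  have good : ∀ y ∈ Algebra.adjoin ℚ
      (Set.range (fun i => j (A i)) ∪ Set.range (fun i => (j (A i))⁻¹)),
      ∃ (N : ℕ) (b : B) (D : ℝ), j b = j P ^ N * y ∧ ∀ φ ∈ Φ, ‖φ b‖ ≤ D := by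
    intro y hy
    induction hy using Algebra.adjoin_induction with
    | mem y hy =>
      rcases hy with ⟨i, rfl⟩ | ⟨i, rfl⟩
      · exact ⟨0, A i, C, by simp, fun φ hφ => hup φ hφ i⟩
      · refine ⟨1, ∏ k ∈ Finset.univ.erase i, A k, ∏ k ∈ Finset.univ.erase i, C, ?_, ?_⟩
        · have h0 : j (A i) ≠ 0 := (map_ne_zero_iff j hj).2 (hA i)
          rw [pow_one, eq_mul_inv_iff_mul_eq₀ h0, ← map_mul,
            Finset.prod_erase_mul _ _ (Finset.mem_univ i)]
        · intro φ hφ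
          rw [map_prod, norm_prod]
          exact Finset.prod_le_prod (fun _ _ => norm_nonneg _) fun k _ => hup φ hφ k
    | algebraMap q =>
      refine ⟨0, algebraMap ℚ B q, ‖(q : ℂ)‖, ?_, fun φ _ => ?_⟩
      · rw [pow_zero, one_mul]
        exact RingHom.congr_fun (RingHom.ext_rat (j.comp (algebraMap ℚ B)) (algebraMap ℚ K)) q
      · have := RingHom.congr_fun
          (RingHom.ext_rat (φ.comp (algebraMap ℚ B)) (algebraMap ℚ ℂ)) q
        rw [RingHom.comp_apply, eq_ratCast (algebraMap ℚ ℂ)] at this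
        rw [this]
    | add y z _ _ hy hz =>
      obtain ⟨N, b, D, h1, h2⟩ := hy
      obtain ⟨N', b', D', h1', h2'⟩ := hz
      have hPb : ∀ N : ℕ, ∀ φ ∈ Φ, ‖φ (P ^ N)‖ ≤ (∏ _i : ι, C) ^ N := fun N φ hφ => by
        rw [map_pow, norm_pow, map_prod, norm_prod]
        exact pow_le_pow_left₀ (Finset.prod_nonneg fun _ _ => norm_nonneg _)
          (Finset.prod_le_prod (fun _ _ => norm_nonneg _) fun k _ => hup φ hφ k) _
      refine ⟨N + N', P ^ N' * b + P ^ N * b',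
        (∏ _i : ι, C) ^ N' * D + (∏ _i : ι, C) ^ N * D', ?_, fun φ hφ => ?_⟩
      · rw [map_add, map_mul, map_mul, map_pow, map_pow, h1, h1']; ring
      · rw [map_add, map_mul, map_mul]
        refine (norm_add_le _ _).trans ?_
        rw [norm_mul, norm_mul]
        exact add_le_add
          (mul_le_mul (hPb _ φ hφ) (h2 φ hφ) (norm_nonneg _)
            ((norm_nonneg _).trans (hPb _ φ hφ)))
          (mul_le_mul (hPb _ φ hφ) (h2' φ hφ) (norm_nonneg _)
            ((norm_nonneg _).trans (hPb _ φ hφ)))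
    | mul y z _ _ hy hz =>
      obtain ⟨N, b, D, h1, h2⟩ := hy
      obtain ⟨N', b', D', h1', h2'⟩ := hz
      refine ⟨N + N', b * b', D * D', ?_, fun φ hφ => ?_⟩
      · rw [map_mul, h1, h1']; ring
      · rw [map_mul, norm_mul]
        exact mul_le_mul (h2 φ hφ) (h2' φ hφ) (norm_nonneg _) ((norm_nonneg _).trans (h2 φ hφ))
  choose N b D hb hD using fun k => good _ (p.coeff k).2
  set m := p.natDegree with hm
  let T : ℕ := ∑ k ∈ Finset.range m, N k
  have hT : ∀ k ∈ Finset.range m, N k ≤ T := fun k hk =>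
    Finset.single_le_sum (fun _ _ => Nat.zero_le _) hk
  -- The equation of integral dependence with denominators cleared, as an identity in `B`.
  have hB : P ^ T * v ^ m + ∑ k ∈ Finset.range m, P ^ (T - N k) * b k * v ^ k = 0 := by
    apply hj
    rw [hp.as_sum, Polynomial.eval₂_add, Polynomial.eval₂_finsetSum] at hpv
    simp only [Polynomial.eval₂_mul, Polynomial.eval₂_C, Polynomial.eval₂_pow,
      Polynomial.eval₂_X] at hpv
    rw [map_zero, map_add, map_mul, map_pow, map_pow, map_sum, ← mul_zero (j P ^ T), ← hpv,
      mul_add, Finset.mul_sum]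
    congr 1
    refine Finset.sum_congr rfl fun k hk => ?_
    rw [map_mul, map_mul, map_pow, map_pow, hb, ← mul_assoc, ← mul_assoc, ← pow_add,
      Nat.sub_add_cancel (hT k hk)]
    rfl
  have hPup : ∀ N : ℕ, ∀ φ ∈ Φ, ‖φ P‖ ^ N ≤ (∏ _i : ι, C) ^ N := fun N φ hφ => by
    rw [map_prod, norm_prod]
    exact pow_le_pow_left₀ (Finset.prod_nonneg fun _ _ => norm_nonneg _)
      (Finset.prod_le_prod (fun _ _ => norm_nonneg _) fun k _ => hup φ hφ k) _
  have hPlow : ∀ N : ℕ, ∀ φ ∈ Φ, (∏ _i : ι, c) ^ N ≤ ‖φ P‖ ^ N := fun N φ hφ => by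
    rw [map_prod, norm_prod]
    exact pow_le_pow_left₀ (Finset.prod_nonneg fun _ _ => hc.le)
      (Finset.prod_le_prod (fun _ _ => hc.le) fun k _ => hlow φ hφ k) _
  have hc0 : 0 < (∏ _i : ι, c) ^ T := pow_pos (Finset.prod_pos fun _ _ => hc) _
  set E : ℝ := ∑ k ∈ Finset.range m, (∏ _i : ι, C) ^ (T - N k) * D k with hE
  obtain ⟨φ, hφ, hlarge⟩ := hv (max 1 (E / (∏ _i : ι, c) ^ T))
  have hx1 : 1 < ‖φ v‖ := (le_max_left _ _).trans_lt hlarge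
  have hx2 : E < ‖φ v‖ * (∏ _i : ι, c) ^ T :=
    (div_lt_iff₀ hc0).1 ((le_max_right _ _).trans_lt hlarge)
  have hφB := congrArg φ hB
  rw [map_add, map_zero, map_sum, add_eq_zero_iff_eq_neg] at hφB
  have hbound : ‖φ (P ^ T * v ^ m)‖ * ‖φ v‖ ≤ E * ‖φ v‖ ^ m := by
    rw [hφB, norm_neg, hE, Finset.sum_mul]
    refine (mul_le_mul_of_nonneg_right (norm_sum_le _ _) (norm_nonneg _)).trans ?_
    rw [Finset.sum_mul]
    refine Finset.sum_le_sum fun k hk => ?_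
    rw [map_mul, map_mul, map_pow, map_pow, norm_mul, norm_mul, norm_pow, norm_pow, mul_assoc,
      ← pow_succ]
    have h1 := hPup (T - N k) φ hφ
    have h2 := hD k φ hφ
    have h0 : 0 ≤ ‖φ P‖ ^ (T - N k) := pow_nonneg (norm_nonneg _) _
    refine mul_le_mul (mul_le_mul h1 h2 (norm_nonneg _) (h0.trans h1)) ?_
      (pow_nonneg (norm_nonneg _) _) (mul_nonneg (h0.trans h1) ((norm_nonneg _).trans h2))
    exact pow_le_pow_right₀ hx1.le (Finset.mem_range.1 hk)
  rw [map_mul, map_pow, map_pow, norm_mul, norm_pow, norm_pow] at hbound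
  have hpos : 0 < ‖φ v‖ ^ m := pow_pos (zero_lt_one.trans hx1) _
  have h3 := hPlow T φ hφ
  have h4 : ‖φ P‖ ^ T * ‖φ v‖ ≤ E := by
    refine le_of_mul_le_mul_right ?_ hpos
    calc _ = ‖φ P‖ ^ T * ‖φ v‖ ^ m * ‖φ v‖ := by ring
      _ ≤ _ := hbound
  have h5 : (∏ _i : ι, c) ^ T * ‖φ v‖ ≤ ‖φ P‖ ^ T * ‖φ v‖ :=
    mul_le_mul_of_nonneg_right h3 (norm_nonneg _)
  linarith

variable {n : ℕ}

theorem exists_eval_len (X : Fin (n + 1) → Fin (n + 1) → ℂ) (hs : ∀ a b, X a b = X b a)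
    (h0 : ∀ a, X a a = 0) : ∃ g : LengthPoly n →+* ℂ, ∀ a b, g (len a b ^ 2) = X a b := by
  choose y hy using fun e : Edge n =>
    IsAlgClosed.exists_pow_nat_eq (Sym2.lift ⟨X, hs⟩ e.1) (n := 2) two_pos
  refine ⟨(MvPolynomial.aeval y).toRingHom, fun a b => ?_⟩
  by_cases hab : a = b
  · subst hab
    rw [len_self, h0, zero_pow two_ne_zero, map_zero]
  · rw [len, dif_neg hab, map_pow]
    have : (MvPolynomial.aeval y).toRingHom (MvPolynomial.X (R := ℚ)
        (⟨s(a, b), by simpa using hab⟩ : Edge n)) = y ⟨s(a, b), by simpa using hab⟩ :=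
      MvPolynomial.aeval_X _ _
    rw [this, hy]
    rfl

theorem faceVol_mem_integralClosure {k : ℕ} (F : Face n k) :
    faceVol F ∈ integralClosure (LengthPoly n) (FF n) := by
  refine IsIntegral.of_pow (n := 2) two_pos ?_
  rw [faceVol_sq, sqVol_eq_algebraMap]
  exact isIntegral_algebraMap

/-- Complex squared edge lengths can be chosen freely, and the volumes of the faces specialise to
square roots of the corresponding values of the Cayley–Menger polynomials. -/
theorem exists_specialization (X : Fin (n + 1) → Fin (n + 1) → ℂ) (hs : ∀ a b, X a b = X b a)
    (h0 : ∀ a, X a a = 0) : ∃ φ : integralClosure (LengthPoly n) (FF n) →+* ℂ,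
      (∀ (F : Face n 2) (e : Fin 3 ≃ F.1), φ ⟨faceVol F, faceVol_mem_integralClosure F⟩ ^ 2 =
        1 / 16 * heron (X (e 0).1 (e 1).1) (X (e 1).1 (e 2).1) (X (e 2).1 (e 0).1)) ∧
      φ ⟨V n, faceVol_mem_integralClosure _⟩ ^ 2 =
        (((-1) ^ (n + 1) / (2 ^ n * (n.factorial : ℚ) ^ 2) : ℚ) : ℂ) * (cmMatrix X).det := by
  obtain ⟨g, hg⟩ := exists_eval_len X hs h0
  have hinj : Function.Injective
      (algebraMap (LengthPoly n) (integralClosure (LengthPoly n) (FF n))) := fun a b hab =>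
    algebraMap_lengthPoly_injective (congrArg Subtype.val hab)
  obtain ⟨φ, hφ⟩ := exists_ringHom_extension hinj g
  have hsq : ∀ {k : ℕ} (F : Face n k), φ ⟨faceVol F, faceVol_mem_integralClosure F⟩ ^ 2 =
      g (sqVolPoly F) := by
    intro k F
    rw [← hφ, ← map_pow]
    congr 1
    apply Subtype.ext
    exact (faceVol_sq F).trans (sqVol_eq_algebraMap F)
  have hC : ∀ q : ℚ, g (MvPolynomial.C q) = (q : ℂ) := fun q =>
    (RingHom.congr_fun (RingHom.ext_rat (g.comp MvPolynomial.C) (algebraMap ℚ ℂ)) q).trans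
      (eq_ratCast _ q)
  refine ⟨φ, fun F e => ?_, ?_⟩
  · rw [hsq, sqVolPoly_eq_heron F e, map_mul, map_heron, hg, hg, hg, hC]
    norm_num
  · refine (hsq _).trans ?_
    rw [sqVolPoly, map_mul, hC, cayleyMengerMatrix_eq,
      ← det_cmMatrix_equiv (Equiv.subtypeUnivEquiv (p := (· ∈ Finset.univ))
        (fun x : Fin (n + 1) => Finset.mem_univ x)).symm, RingHom.map_det,
      RingHom.mapMatrix_apply, cmMatrix_map]
    congr 3
    funext a b
    exact hg a b

end Specialization

/-! ### A degenerating family of simplices -/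

section Family

/-- Vertices congruent modulo `4` have type `0`; otherwise the type is `1` or `2` according to
whether their residues lie in the same pair `{0, 1}` or `{2, 3}`. -/
def edgeType (a b : ℕ) : ℕ :=
  if a % 4 = b % 4 then 0 else if a % 4 / 2 = b % 4 / 2 then 1 else 2

/-- Squared edge lengths of a simplex on at most six vertices: the vertices congruent modulo `4`
are at squared distance `q`, and the residues form a tetrahedron with opposite edges `z`, `y`,
`y`. -/
def cluster {R : Type*} [CommRing R] (q z y : R) (a b : ℕ) : R :=
  if a = b then 0 else if edgeType a b = 0 then q else if edgeType a b = 1 then z else y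

variable {R : Type*} [CommRing R] (q z y : R)

theorem edgeType_comm (a b : ℕ) : edgeType a b = edgeType b a := by
  simp only [edgeType, eq_comm]

theorem cluster_comm (a b : ℕ) : cluster q z y a b = cluster q z y b a := by
  simp only [cluster, edgeType_comm a b, eq_comm]

theorem cluster_self (a : ℕ) : cluster q z y a a = 0 := if_pos rfl

theorem edgeType_triangle : ∀ a b c : Fin 6, a ≠ b → b ≠ c → c ≠ a →
    (edgeType a b, edgeType b c, edgeType c a) ∈
      [(1, 2, 2), (2, 1, 2), (2, 2, 1), (0, 1, 1), (1, 0, 1), (1, 1, 0), (0, 2, 2), (2, 0, 2),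
        (2, 2, 0)] := by
  decide

theorem heron_cluster {a b c : ℕ} (ha : a < 6) (hb : b < 6) (hc : c < 6) (hab : a ≠ b)
    (hbc : b ≠ c) (hca : c ≠ a) :
    heron (cluster q z y a b) (cluster q z y b c) (cluster q z y c a) ∈
      ({z * (4 * y - z), q * (4 * z - q), q * (4 * y - q)} : Set R) := by
  have h := edgeType_triangle ⟨a, ha⟩ ⟨b, hb⟩ ⟨c, hc⟩ (by simpa using hab)
    (by simpa using hbc) (by simpa using hca)
  simp only [cluster, if_neg hab, if_neg hbc, if_neg hca, Set.mem_insert_iff,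
    Set.mem_singleton_iff]
  simp only [List.mem_cons, Prod.mk.injEq, List.not_mem_nil, or_false] at h
  rcases h with ⟨h1, h2, h3⟩ | ⟨h1, h2, h3⟩ | ⟨h1, h2, h3⟩ | ⟨h1, h2, h3⟩ | ⟨h1, h2, h3⟩ |
    ⟨h1, h2, h3⟩ | ⟨h1, h2, h3⟩ | ⟨h1, h2, h3⟩ | ⟨h1, h2, h3⟩ <;>
  simp only [h1, h2, h3, heron, if_true, one_ne_zero, two_ne_zero, if_false,
    show (2 : ℕ) ≠ 1 by decide]
  · left; ring
  · left; ring
  · left; ring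
  · right; left; ring
  · right; left; ring
  · right; left; ring
  · right; right; ring
  · right; right; ring
  · right; right; ring

/-- If the last row is a multiple of the last unit vector, the determinant is that multiple of a
principal minor. -/
theorem det_of_last_row {m : ℕ} (M : Matrix (Fin (m + 1)) (Fin (m + 1)) R)
    (h : ∀ j : Fin m, M (Fin.last m) j.castSucc = 0) :
    M.det = M (Fin.last m) (Fin.last m) * (M.submatrix Fin.castSucc Fin.castSucc).det := by
  rw [Matrix.det_succ_row M (Fin.last m), Fin.sum_univ_castSucc]
  simp [h, ← two_mul]

/-- The bordered matrix of the first `k` points of the cluster configuration. -/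
def clusterMatrix (k : ℕ) : Matrix (Option (Fin k)) (Option (Fin k)) R :=
  cmMatrix fun a b => cluster q z y a b

theorem det_cmMatrix_eq {k : ℕ} (x : Fin k → Fin k → R)
    (M : Matrix (Fin (k + 1)) (Fin (k + 1)) R) (h00 : M 0 0 = 0) (h0 : ∀ j : Fin k, M 0 j.succ = 1)
    (h1 : ∀ i : Fin k, M i.succ 0 = 1) (h : ∀ i j : Fin k, x i j = M i.succ j.succ) :
    (cmMatrix x).det = M.det := by
  rw [← Matrix.det_submatrix_equiv_self (finSuccEquiv k)]
  congr 1
  ext i j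
  refine Fin.cases ?_ (fun i => ?_) i <;> refine Fin.cases ?_ (fun j => ?_) j <;>
    simp [cmMatrix, h00, h0, h1, h]

theorem det_clusterMatrix_four :
    (clusterMatrix q z y 4).det = 4 * z ^ 2 * (2 * y - z) := by
  rw [clusterMatrix, det_cmMatrix_eq _
      !![0, 1, 1, 1, 1; 1, 0, z, y, y; 1, z, 0, y, y; 1, y, y, 0, z; 1, y, y, z, 0] rfl
    (by intro j; fin_cases j <;> rfl) (by intro i; fin_cases i <;> rfl)
    (by intro i j; fin_cases i <;> fin_cases j <;> simp [cluster, edgeType])]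
  simp [Matrix.det_succ_row_zero, Fin.sum_univ_succ, Fin.succAbove]
  ring

theorem det_clusterMatrix_five :
    (clusterMatrix q z y 5).det = -q * (8 * z ^ 2 * (2 * y - z) - q * z * (4 * y - z)) := by
  rw [clusterMatrix, det_cmMatrix_eq _
      !![0, 1, 1, 1, 1, 1; 1, 0, z, y, y, q; 1, z, 0, y, y, z; 1, y, y, 0, z, y;
        1, y, y, z, 0, y; 1, q, z, y, y, 0] rfl
    (by intro j; fin_cases j <;> rfl) (by intro i; fin_cases i <;> rfl)
    (by intro i j; fin_cases i <;> fin_cases j <;> simp [cluster, edgeType])]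
  -- Subtract row `0` from row `4`, then add column `4` to column `0`.
  rw [Matrix.det_eq_of_forall_row_eq_smul_add_const (B :=
    !![0, 1, 1, 1, 1, 1; 1, 0, z, y, y, q; 1, z, 0, y, y, z; 1, y, y, 0, z, y;
        1, y, y, z, 0, y; 0, q, 0, 0, 0, -q]) ![0, 0, 0, 0, 0, 1] 1 (by simp)
    (by intro i j; fin_cases i <;> fin_cases j <;> simp)]
  rw [← Matrix.det_transpose, Matrix.det_eq_of_forall_row_eq_smul_add_const (B :=
    !![0, 2, 1, 1, 1, 1; 1, q, z, y, y, q; 1, 2 * z, 0, y, y, z; 1, 2 * y, y, 0, z, y;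
        1, 2 * y, y, z, 0, y; 0, 0, 0, 0, 0, -q].transpose) ![0, -1, 0, 0, 0, 0] 5 (by simp)
    (by intro i j; fin_cases i <;> fin_cases j <;> simp <;> ring), Matrix.det_transpose]
  rw [det_of_last_row _ (by intro j; fin_cases j <;> rfl)]
  have e' : Matrix.submatrix !![0, 2, 1, 1, 1, 1; 1, q, z, y, y, q; 1, 2 * z, 0, y, y, z;
      1, 2 * y, y, 0, z, y; 1, 2 * y, y, z, 0, y; 0, 0, 0, 0, 0, -q] Fin.castSucc Fin.castSucc =
      !![0, 2, 1, 1, 1; 1, q, z, y, y; 1, 2 * z, 0, y, y; 1, 2 * y, y, 0, z;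
        1, 2 * y, y, z, 0] := by
    ext i j; fin_cases i <;> fin_cases j <;> rfl
  rw [e']
  simp [Matrix.det_succ_row_zero, Fin.sum_univ_succ, Fin.succAbove]
  ring

theorem det_clusterMatrix_six :
    (clusterMatrix q z y 6).det =
      q ^ 2 * (16 * z ^ 2 * (2 * y - z) - 4 * q * z * (4 * y - z) + 2 * q ^ 2 * z) := by
  rw [clusterMatrix, det_cmMatrix_eq _
      !![0, 1, 1, 1, 1, 1, 1; 1, 0, z, y, y, q, z; 1, z, 0, y, y, z, q; 1, y, y, 0, z, y, y;
        1, y, y, z, 0, y, y; 1, q, z, y, y, 0, z; 1, z, q, y, y, z, 0] rfl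
    (by intro j; fin_cases j <;> rfl) (by intro i; fin_cases i <;> rfl)
    (by intro i j; fin_cases i <;> fin_cases j <;> simp [cluster, edgeType])]
  -- Subtract rows `0` and `1` from rows `4` and `5`, then add columns `4` and `5` to columns `0`
  -- and `1`.
  rw [Matrix.det_eq_of_forall_row_eq_smul_add_const (B :=
    !![0, 1, 1, 1, 1, 1, 1; 1, 0, z, y, y, q, z; 1, z, 0, y, y, z, q; 1, y, y, 0, z, y, y;
        1, y, y, z, 0, y, y; 0, q, 0, 0, 0, -q, 0; 1, z, q, y, y, z, 0])
    ![0, 0, 0, 0, 0, 1, 0] 1 (by simp) (by intro i j; fin_cases i <;> fin_cases j <;> simp)]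
  rw [Matrix.det_eq_of_forall_row_eq_smul_add_const (B :=
    !![0, 1, 1, 1, 1, 1, 1; 1, 0, z, y, y, q, z; 1, z, 0, y, y, z, q; 1, y, y, 0, z, y, y;
        1, y, y, z, 0, y, y; 0, q, 0, 0, 0, -q, 0; 0, 0, q, 0, 0, 0, -q])
    ![0, 0, 0, 0, 0, 0, 1] 2 (by simp) (by intro i j; fin_cases i <;> fin_cases j <;> simp)]
  rw [← Matrix.det_transpose, Matrix.det_eq_of_forall_row_eq_smul_add_const (B :=
    !![0, 2, 1, 1, 1, 1, 1; 1, q, z, y, y, q, z; 1, 2 * z, 0, y, y, z, q;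
        1, 2 * y, y, 0, z, y, y; 1, 2 * y, y, z, 0, y, y; 0, 0, 0, 0, 0, -q, 0;
        0, 0, q, 0, 0, 0, -q].transpose) ![0, -1, 0, 0, 0, 0, 0] 5 (by simp)
    (by intro i j; fin_cases i <;> fin_cases j <;> simp <;> ring)]
  rw [Matrix.det_eq_of_forall_row_eq_smul_add_const (B :=
    !![0, 2, 2, 1, 1, 1, 1; 1, q, 2 * z, y, y, q, z; 1, 2 * z, q, y, y, z, q;
        1, 2 * y, 2 * y, 0, z, y, y; 1, 2 * y, 2 * y, z, 0, y, y; 0, 0, 0, 0, 0, -q, 0;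
        0, 0, 0, 0, 0, 0, -q].transpose) ![0, 0, -1, 0, 0, 0, 0] 6 (by simp)
    (by intro i j; fin_cases i <;> fin_cases j <;> simp <;> ring), Matrix.det_transpose]
  rw [det_of_last_row _ (by intro j; fin_cases j <;> rfl),
    det_of_last_row _ (by intro j; fin_cases j <;> rfl), Matrix.submatrix_submatrix]
  have e' : Matrix.submatrix !![0, 2, 2, 1, 1, 1, 1; 1, q, 2 * z, y, y, q, z;
        1, 2 * z, q, y, y, z, q; 1, 2 * y, 2 * y, 0, z, y, y; 1, 2 * y, 2 * y, z, 0, y, y;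
        0, 0, 0, 0, 0, -q, 0; 0, 0, 0, 0, 0, 0, -q]
        (Fin.castSucc ∘ Fin.castSucc) (Fin.castSucc ∘ Fin.castSucc) =
      !![0, 2, 2, 1, 1; 1, q, 2 * z, y, y; 1, 2 * z, q, y, y; 1, 2 * y, 2 * y, 0, z;
        1, 2 * y, 2 * y, z, 0] := by
    ext i j; fin_cases i <;> fin_cases j <;> rfl
  rw [e']
  simp [Matrix.det_succ_row_zero, Fin.sum_univ_succ, Fin.succAbove]
  ring

end Family

/-! ### Unbounded volume in dimensions three, four and five -/

section Unbounded

theorem heron_cluster_mem_Icc {τ : ℝ} (hτ : 1 ≤ τ) {a b c : ℕ} (ha : a < 6) (hb : b < 6)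
    (hc : c < 6) (hab : a ≠ b) (hbc : b ≠ c) (hca : c ≠ a) :
    heron (cluster τ⁻¹ (4 * τ - τ⁻¹) τ a b) (cluster τ⁻¹ (4 * τ - τ⁻¹) τ b c)
      (cluster τ⁻¹ (4 * τ - τ⁻¹) τ c a) ∈ Set.Icc (3 : ℝ) 16 := by
  have h := heron_cluster τ⁻¹ (4 * τ - τ⁻¹) τ ha hb hc hab hbc hca
  have h1 : τ * τ⁻¹ = 1 := mul_inv_cancel₀ (by positivity)
  have h2 : τ⁻¹ ≤ 1 := inv_le_one_of_one_le₀ hτ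
  have h3 : 0 < τ⁻¹ := by positivity
  generalize τ⁻¹ = σ at *
  have h4 : σ ^ 2 ≤ 1 := pow_le_one₀ h3.le h2
  have h5 : 0 < σ ^ 2 := pow_pos h3 2
  simp only [Set.mem_insert_iff, Set.mem_singleton_iff] at h
  rcases h with h | h | h
  · have : (4 * τ - σ) * (4 * τ - (4 * τ - σ)) = 4 - σ ^ 2 := by linear_combination 4 * h1
    rw [h, this]; constructor <;> linarith
  · have : σ * (4 * (4 * τ - σ) - σ) = 16 - 5 * σ ^ 2 := by linear_combination 16 * h1
    rw [h, this]; constructor <;> linarith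
  · have : σ * (4 * τ - σ) = 4 - σ ^ 2 := by linear_combination 4 * h1
    rw [h, this]; constructor <;> linarith

theorem le_abs_det_clusterMatrix {τ : ℝ} (hτ : 1 ≤ τ) {n : ℕ} (h3 : 3 ≤ n) (h5 : n < 6) :
    τ ≤ |(clusterMatrix τ⁻¹ (4 * τ - τ⁻¹) τ (n + 1)).det| := by
  have e1 : τ * τ⁻¹ = 1 := mul_inv_cancel₀ (by positivity)
  have e2 : τ⁻¹ ≤ 1 := inv_le_one_of_one_le₀ hτ
  have e3 : 0 < τ⁻¹ := by positivity
  generalize τ⁻¹ = σ at *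
  obtain ⟨z, hz⟩ : ∃ z, z = 4 * τ - σ := ⟨_, rfl⟩
  obtain ⟨w, hw⟩ : ∃ w, w = 2 * τ - σ := ⟨_, rfl⟩
  have hz3 : 3 ≤ z := by linarith
  have hwτ : τ ≤ w := by linarith
  have hσz : 3 ≤ σ * z := by
    have : σ * z = 4 - σ ^ 2 := by rw [hz]; linear_combination 4 * e1
    rw [this]
    linarith [pow_le_one₀ (n := 2) e3.le e2]
  have h2 : 2 * τ - z = -w := by linarith
  have h4 : 4 * τ - z = σ := by linarith
  rw [← hz]
  interval_cases n
  · refine le_trans ?_ (neg_le_abs _)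
    rw [det_clusterMatrix_four, h2]
    have : 9 ≤ z ^ 2 := by nlinarith
    nlinarith [mul_le_mul this hwτ (by linarith) (by positivity)]
  · refine le_trans ?_ (le_abs_self _)
    rw [det_clusterMatrix_five, h2, h4]
    have h6 : -σ * (8 * z ^ 2 * -w - σ * z * σ) =
        8 * (σ * z * z * w) + σ * σ * (σ * z) := by ring
    have h7 : 9 ≤ σ * z * z := by nlinarith
    have h8 : 9 * τ ≤ σ * z * z * w := mul_le_mul h7 hwτ (by linarith) (by linarith)
    have h9 : 0 ≤ σ * σ * (σ * z) := by positivity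
    linarith
  · refine le_trans ?_ (neg_le_abs _)
    rw [det_clusterMatrix_six, h2, h4]
    have h6 : -(σ ^ 2 * (16 * z ^ 2 * -w - 4 * σ * z * σ + 2 * σ ^ 2 * z)) =
        16 * ((σ * z) * (σ * z) * w) + 2 * (σ ^ 2 * σ * (σ * z)) := by ring
    have h7 : 9 ≤ (σ * z) * (σ * z) := by nlinarith
    have h8 : 9 * τ ≤ (σ * z) * (σ * z) * w := mul_le_mul h7 hwτ (by linarith) (by linarith)
    have h9 : 0 ≤ σ ^ 2 * σ * (σ * z) := by positivity
    linarith

theorem not_isIntegral_V {n : ℕ} (h3 : 3 ≤ n) (h6 : n < 6) :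
    ¬ IsIntegral (laurentAlg n 2) (V n) := by
  let B := integralClosure (LengthPoly n) (FF n)
  let A : Face n 2 → B := fun F => ⟨faceVol F, faceVol_mem_integralClosure F⟩
  let v : B := ⟨V n, faceVol_mem_integralClosure _⟩
  let Φ : Set (B →+* ℂ) := {φ | ∀ F, 1 / 4 ≤ ‖φ (A F)‖ ∧ ‖φ (A F)‖ ≤ 1}
  refine not_isIntegral_of_unbounded (algebraMap B (FF n)) Subtype.val_injective A
    (fun F h => faceVol_ne_zero F (congrArg Subtype.val h)) v Φ (c := 1 / 4) (C := 1) (by norm_num)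
    (fun φ hφ F => (hφ F).1) (fun φ hφ F => (hφ F).2) fun M => ?_
  set κ : ℚ := (-1) ^ (n + 1) / (2 ^ n * (n.factorial : ℚ) ^ 2) with hκ
  have hκ0 : 0 < ‖(κ : ℂ)‖ := by
    rw [norm_pos_iff, Rat.cast_ne_zero, hκ]
    positivity
  obtain ⟨τ, hτ1, hτ⟩ : ∃ τ : ℝ, 1 ≤ τ ∧ (M ^ 2 + 1) / ‖(κ : ℂ)‖ ≤ τ :=
    ⟨max 1 ((M ^ 2 + 1) / ‖(κ : ℂ)‖), le_max_left _ _, le_max_right _ _⟩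
  let x : Fin (n + 1) → Fin (n + 1) → ℝ := fun a b => cluster τ⁻¹ (4 * τ - τ⁻¹) τ a b
  obtain ⟨φ, hφA, hφV⟩ := exists_specialization (fun a b => (x a b : ℂ))
    (fun a b => by simp only [x, cluster_comm]) (fun a => by simp only [x, cluster_self]; simp)
  refine ⟨φ, fun F => ?_, ?_⟩
  · obtain ⟨e⟩ := exists_equiv_of_face F
    have hne : ∀ i j, i ≠ j → ((e i).1 : ℕ) ≠ (e j).1 := fun i j hij h =>
      hij (e.injective (Subtype.ext (Fin.ext h)))
    have hlt : ∀ i, ((e i).1 : ℕ) < 6 := fun i => by have := (e i).1.2; omega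
    have hmem := heron_cluster_mem_Icc hτ1 (hlt 0) (hlt 1) (hlt 2) (hne 0 1 (by decide))
      (hne 1 2 (by decide)) (hne 2 0 (by decide))
    have hA := congrArg norm (hφA F e)
    have hreal : heron (x (e 0).1 (e 1).1 : ℂ) (x (e 1).1 (e 2).1) (x (e 2).1 (e 0).1) =
        (heron (x (e 0).1 (e 1).1) (x (e 1).1 (e 2).1) (x (e 2).1 (e 0).1) : ℝ) :=
      (map_heron Complex.ofRealHom _ _ _).symm
    rw [hreal, norm_pow, norm_mul, Complex.norm_real, Real.norm_of_nonneg (by linarith [hmem.1])]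
      at hA
    have h16 : ‖(1 / 16 : ℂ)‖ = 1 / 16 := by norm_num
    rw [h16] at hA
    have h0 : 0 ≤ ‖φ (A F)‖ := norm_nonneg _
    constructor
    · refine le_of_sq_le_sq ?_ h0
      rw [hA]
      linarith [hmem.1]
    · refine le_of_sq_le_sq ?_ zero_le_one
      rw [hA]
      linarith [hmem.2]
  · have hdet : (cmMatrix fun a b => (x a b : ℂ)).det =
        ((clusterMatrix τ⁻¹ (4 * τ - τ⁻¹) τ (n + 1)).det : ℝ) := by
      have := RingHom.map_det Complex.ofRealHom (clusterMatrix τ⁻¹ (4 * τ - τ⁻¹) τ (n + 1))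
      rw [RingHom.mapMatrix_apply, clusterMatrix, cmMatrix_map] at this
      exact this.symm
    have hV := congrArg norm hφV
    rw [hdet, norm_pow, norm_mul, Complex.norm_real, Real.norm_eq_abs] at hV
    have hbig := le_abs_det_clusterMatrix hτ1 h3 h6
    have h1 : M ^ 2 + 1 ≤ ‖φ v‖ ^ 2 := by
      rw [hV]
      rw [div_le_iff₀ hκ0] at hτ
      calc _ ≤ τ * ‖(κ : ℂ)‖ := hτ
        _ ≤ |(clusterMatrix τ⁻¹ (4 * τ - τ⁻¹) τ (n + 1)).det| * ‖(κ : ℂ)‖ :=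
          mul_le_mul_of_nonneg_right hbig hκ0.le
        _ = _ := mul_comm _ _
    exact lt_of_pow_lt_pow_left₀ 2 (norm_nonneg _) (by linarith)

end Unbounded

end SimplexVolume

theorem mainTheorem2 (n : ℕ) (hn : 3 ≤ n) :
    (IsIntegral (SimplexVolume.laurentAlg n 2) (SimplexVolume.V n) ↔ 6 ≤ n) ∧
    (6 ≤ n → IsIntegral (SimplexVolume.regularAlg n 2) (SimplexVolume.V n)) := by
  refine ⟨⟨fun h => ?_, SimplexVolume.isIntegral_V⟩, fun h => ?_⟩
  · by_contra hlt
    exact SimplexVolume.not_isIntegral_V hn (not_le.1 hlt) h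
  · obtain ⟨p, hp, hpv⟩ := SimplexVolume.isIntegral_V h
    let i := Subalgebra.inclusion (SimplexVolume.laurentAlg_le_regularAlg n)
    refine ⟨p.map i.toRingHom, hp.map _, ?_⟩
    rw [Polynomial.eval₂_map]
    exact hpv
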